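/- Let $N\ge 2$ and let $\Omega\subseteq\mathbb R^N$ be a bounded domain (nonempty, open, connected) with Lipschitz boundary. Let $p,q\in C(\overline\Omega)$ satisfy $1<p(x)<N$ and $p(x)<q(x)<p^*(x):=\frac{Np(x)}{N-p(x)}$ for all $x\in\overline\Omega$, and let $\mu\in L^\infty(\Omega)$ with $\mu\ge 0$ almost everywhere. Put $\mathcal H(x,t)=t^{p(x)}+\mu(x)t^{q(x)}$ for $x\in\Omega$, $t\ge 0$, and $\rho_{\mathcal H}(u)=\int_\Omega \mathcal H(x,|u(x)|)\,dx$. Let $L^{\mathcal H}(\Omega)$ be the Musielak--Orlicz space of all (classes modulo null sets of) measurable $u\colon\Omega\to\mathbb R$ such that $\rho_{\mathcal H}(\alpha u)<\infty$ for some $\alpha>0$, with the Luxemburg norm $\|u\|_{\mathcal H}=\inf\{\tau>0:\rho_{\mathcal H}(u/\tau)\le 1\}$. Let $W^{1,\mathcal H}(\Omega)$ be the space of all $u\in L^{\mathcal H}(\Omega)$ that have a weak gradient $\nabla u$ with $|\nabla u|\in L^{\mathcal H}(\Omega)$, with the norm $\|u\|_{1,\mathcal H}=\|u\|_{\mathcal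 H}+\|\nabla u\|_{\mathcal H}$, where $\|\nabla u\|_{\mathcal H}=\|\,|\nabla u|\,\|_{\mathcal H}$, and let $W^{1,\mathcal H}_0(\Omega)$ be the closure of $C_0^\infty(\Omega)$ in $W^{1,\mathcal H}(\Omega)$. Then: (i) the embedding $W^{1,\mathcal H}(\Omega)\hookrightarrow L^{\mathcal H}(\Omega)$ is compact (the inclusion map is an injective compact linear operator); (ii) there is a constant $C>0$ such that $\|u\|_{\mathcal H}\le C\|\nabla u\|_{\mathcal H}$ for all $u\in W^{1,\mathcal H}_0(\Omega)$; (iii) consequently $u\mapsto\|\nabla u\|_{\mathcal H}$ is a norm on $W^{1,\mathcal H}_0(\Omega)$ which is equivalent to $\|\cdot\|_{1,\mathcal H}$. -/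

import Mathlib

open MeasureTheory Set
open scoped ENNReal ContDiff

noncomputable section

namespace DoublePhase

/-- `ℝ^N` with the Euclidean norm. -/
abbrev Euc (N : ℕ) : Type := EuclideanSpace ℝ (Fin N)

/-- `Ω` has a Lipschitz boundary: near each boundary point, `Ω` is the set of points lying strictly
above the graph of a Lipschitz function, in the direction of some unit vector `e`. The function
`γ` depends only on the component of the point orthogonal to `e`. -/
def HasLipschitzBoundary {N : ℕ} (Ω : Set (Euc N)) : Prop :=
  ∀ x ∈ frontier Ω, ∃ (e : Euc N) (γ : Euc N → ℝ) (K : NNReal) (r : ℝ),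
    ‖e‖ = 1 ∧ LipschitzWith K γ ∧ (∀ (y : Euc N) (t : ℝ), γ (y + t • e) = γ y) ∧ 0 < r ∧
      ∀ y ∈ Metric.ball x r, y ∈ Ω ↔ γ y < inner ℝ e y

/-- Smooth real functions on `ℝ^N` with compact support contained in `Ω`, i.e. `C_0^∞(Ω)`. -/
structure IsTestFunction {N : ℕ} (Ω : Set (Euc N)) (φ : Euc N → ℝ) : Prop where
  smooth : ContDiff ℝ ∞ φ
  hasCompactSupport : HasCompactSupport φ
  tsupport_subset : tsupport φ ⊆ Ω

/-- `G` is the weak (distributional) gradient of `u` in `Ω`; both are locally integrable in `Ω`. -/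
structure HasWeakGradient {N : ℕ} (Ω : Set (Euc N)) (u : Euc N → ℝ) (G : Euc N → Euc N) :
    Prop where
  locInt : ∀ K ⊆ Ω, IsCompact K → IntegrableOn u K
  locInt_grad : ∀ K ⊆ Ω, IsCompact K → IntegrableOn G K
  integral_eq : ∀ φ : Euc N → ℝ, IsTestFunction Ω φ → ∀ i : Fin N,
    ∫ x in Ω, u x * fderiv ℝ φ x (EuclideanSpace.single i 1) = -∫ x in Ω, G x i * φ x

/-- The data of the function `H(x,t) = t^{p(x)} + μ(x) t^{q(x)}` on an open set `Ω`, with exactly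
what is needed for the spaces below to be normed spaces: continuous exponents `1 < p < q` on the
closure of `Ω` and a nonnegative measurable weight `μ`. -/
structure Data (N : ℕ) where
  Ω : Set (Euc N)
  p : Euc N → ℝ
  q : Euc N → ℝ
  μ : Euc N → ℝ
  isOpen : IsOpen Ω
  continuousOn_p : ContinuousOn p (closure Ω)
  continuousOn_q : ContinuousOn q (closure Ω)
  one_lt_p : ∀ x ∈ closure Ω, 1 < p x
  p_lt_q : ∀ x ∈ closure Ω, p x < q x
  aemeasurable_μ : AEMeasurable μ (volume.restrict Ω)
  μ_nonneg : ∀ᵐ x ∂volume.restrict Ω, 0 ≤ μ x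

/-- The critical Sobolev exponent `p^* = N p / (N - p)` (for `p < N`). -/
def sobolevConj (N : ℕ) (p : ℝ) : ℝ := N * p / (N - p)

namespace Data

set_option linter.unusedSectionVars false

variable {N : ℕ} (D : Data N) {F : Type*} [NormedAddCommGroup F] [NormedSpace ℝ F]

/-- `H(x,t) = t^{p(x)} + μ(x) t^{q(x)}`. -/
def H (x : Euc N) (t : ℝ) : ℝ := t ^ D.p x + D.μ x * t ^ D.q x

/-- Measurable functions `Ω → F` modulo equality Lebesgue-almost everywhere. -/
abbrev M (F : Type*) [NormedAddCommGroup F] : Type _ := Euc N →ₘ[volume.restrict D.Ω] F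

/-- The modular `ρ_H(u) = ∫_Ω H(x,|u(x)|) dx ∈ [0,∞]`. -/
def modular (u : D.M F) : ℝ≥0∞ :=
  ∫⁻ x in D.Ω, ENNReal.ofReal (D.H x ‖u x‖)

theorem ae_good : ∀ᵐ x ∂volume.restrict D.Ω, 1 < D.p x ∧ 1 < D.q x ∧ 0 ≤ D.μ x := by
  filter_upwards [D.μ_nonneg, ae_restrict_mem D.isOpen.measurableSet] with x hx hxΩ
  have h1 := D.one_lt_p x (subset_closure hxΩ)
  exact ⟨h1, h1.trans (D.p_lt_q x (subset_closure hxΩ)), hx⟩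

theorem aemeasurable_H (u : D.M F) :
    AEMeasurable (fun x => ENNReal.ofReal (D.H x ‖u x‖)) (volume.restrict D.Ω) := by
  have hu : AEMeasurable (fun x => ‖u x‖) (volume.restrict D.Ω) :=
    u.aestronglyMeasurable.norm.aemeasurable
  have hp : AEMeasurable D.p (volume.restrict D.Ω) :=
    (D.continuousOn_p.mono subset_closure).aemeasurable D.isOpen.measurableSet
  have hq : AEMeasurable D.q (volume.restrict D.Ω) :=
    (D.continuousOn_q.mono subset_closure).aemeasurable D.isOpen.measurableSet
  have hμ := D.aemeasurable_μ
  exact ((hu.pow hp).add (hμ.mul (hu.pow hq))).ennreal_ofReal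

theorem H_nonneg {x : Euc N} (hμ : 0 ≤ D.μ x) {t : ℝ} (ht : 0 ≤ t) : 0 ≤ D.H x t := by
  unfold H; positivity

theorem H_convex {x : Euc N} (hp : 1 < D.p x) (hq : 1 < D.q x) (hμ : 0 ≤ D.μ x)
    {s t a b r : ℝ} (hs : 0 ≤ s) (ht : 0 ≤ t) (ha : 0 ≤ a) (hb : 0 ≤ b) (hab : a + b = 1)
    (hr : 0 ≤ r) (hrs : r ≤ a * s + b * t) :
    D.H x r ≤ a * D.H x s + b * D.H x t := by
  have key : ∀ z : ℝ, 1 < z → r ^ z ≤ a * s ^ z + b * t ^ z := fun z hz =>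
    (Real.rpow_le_rpow hr hrs (by linarith)).trans
      (by simpa using (convexOn_rpow hz.le).2 (mem_Ici.2 hs) (mem_Ici.2 ht) ha hb hab)
  have h1 := key _ hp
  have h2 := mul_le_mul_of_nonneg_left (key _ hq) hμ
  unfold H
  nlinarith

theorem modular_convex (u v : D.M F) {a b : ℝ} (ha : 0 ≤ a) (hb : 0 ≤ b) (hab : a + b = 1) :
    D.modular (a • u + b • v)
      ≤ ENNReal.ofReal a * D.modular u + ENNReal.ofReal b * D.modular v := by
  unfold modular
  rw [← lintegral_const_mul'' _ (D.aemeasurable_H u), ← lintegral_const_mul'' _ (D.aemeasurable_H v),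
    ← lintegral_add_left' ((D.aemeasurable_H u).const_mul _)]
  refine lintegral_mono_ae ?_
  filter_upwards [D.ae_good, AEEqFun.coeFn_add (a • u) (b • v), AEEqFun.coeFn_smul a u,
    AEEqFun.coeFn_smul b v] with x hx h1 h2 h3
  obtain ⟨hp, hq, hμ⟩ := hx
  rw [← ENNReal.ofReal_mul ha, ← ENNReal.ofReal_mul hb, ← ENNReal.ofReal_add
    (mul_nonneg ha (D.H_nonneg hμ (norm_nonneg _))) (mul_nonneg hb (D.H_nonneg hμ (norm_nonneg _)))]
  refine ENNReal.ofReal_le_ofReal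
    (D.H_convex hp hq hμ (norm_nonneg _) (norm_nonneg _) ha hb hab (norm_nonneg _) ?_)
  rw [h1, Pi.add_apply, h2, h3, Pi.smul_apply, Pi.smul_apply]
  refine (norm_add_le _ _).trans ?_
  rw [norm_smul, norm_smul, Real.norm_of_nonneg ha, Real.norm_of_nonneg hb]

theorem modular_zero : D.modular (0 : D.M F) = 0 := by
  unfold modular
  rw [lintegral_eq_zero_iff' (D.aemeasurable_H 0)]
  filter_upwards [D.ae_good, AEEqFun.coeFn_zero (α := Euc N) (β := F)
    (μ := volume.restrict D.Ω)] with x hx h0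
  have h1 : D.p x ≠ 0 := by linarith [hx.1]
  have h2 : D.q x ≠ 0 := by linarith [hx.2.1]
  rw [h0]
  simp [H, Real.zero_rpow h1, Real.zero_rpow h2]

theorem modular_smul_le (u : D.M F) {a : ℝ} (ha : 0 ≤ a) (ha1 : a ≤ 1) :
    D.modular (a • u) ≤ ENNReal.ofReal a * D.modular u := by
  have h := D.modular_convex u 0 ha (sub_nonneg.2 ha1) (by ring)
  rwa [smul_zero, add_zero, modular_zero, mul_zero, add_zero] at h

theorem modular_congr (u : D.M F) {c d : ℝ} (h : |c| = |d|) :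
    D.modular (c • u) = D.modular (d • u) := by
  unfold modular
  refine lintegral_congr_ae ?_
  filter_upwards [AEEqFun.coeFn_smul c u, AEEqFun.coeFn_smul d u] with x h1 h2
  rw [h1, h2, Pi.smul_apply, Pi.smul_apply, norm_smul, norm_smul, Real.norm_eq_abs,
    Real.norm_eq_abs, h]

theorem modular_eq_zero {u : D.M F} (h : D.modular u = 0) : u = 0 := by
  unfold modular at h
  rw [lintegral_eq_zero_iff' (D.aemeasurable_H u)] at h
  refine AEEqFun.ext ?_
  filter_upwards [D.ae_good, h, AEEqFun.coeFn_zero (α := Euc N) (β := F)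
    (μ := volume.restrict D.Ω)] with x hx h1 h0
  rw [h0]
  by_contra hne
  have hpos : 0 < ‖u x‖ := norm_pos_iff.2 hne
  have h2 : D.H x ‖u x‖ ≤ 0 := ENNReal.ofReal_eq_zero.1 h1
  have h3 : 0 < ‖u x‖ ^ D.p x := Real.rpow_pos_of_pos hpos _
  have h4 : 0 ≤ D.μ x * ‖u x‖ ^ D.q x := mul_nonneg hx.2.2 (by positivity)
  unfold H at h2
  linarith

/-- The linear subspace of all `u` with `ρ_H(α u) < ∞` for some `α > 0`. -/
def lhSubmodule (F : Type*) [NormedAddCommGroup F] [NormedSpace ℝ F] : Submodule ℝ (D.M F) where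
  carrier := {u | ∃ α : ℝ, 0 < α ∧ D.modular (α • u) < ⊤}
  zero_mem' := ⟨1, one_pos, by rw [smul_zero, modular_zero]; simp⟩
  add_mem' := by
    rintro u v ⟨α, hα, hu⟩ ⟨β, hβ, hv⟩
    have hs : 0 < α + β := by positivity
    refine ⟨α * β / (α + β), by positivity, ?_⟩
    have h := D.modular_convex (α • u) (β • v) (a := β / (α + β)) (b := α / (α + β))
      (by positivity) (by positivity) (by field_simp; ring)
    rw [smul_smul, smul_smul, show β / (α + β) * α = α * β / (α + β) by ring,
      show α / (α + β) * β = α * β / (α + β) by ring, ← smul_add] at h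
    exact h.trans_lt (ENNReal.add_lt_top.2
      ⟨ENNReal.mul_lt_top ENNReal.ofReal_lt_top hu, ENNReal.mul_lt_top ENNReal.ofReal_lt_top hv⟩)
  smul_mem' := by
    rintro c u ⟨α, hα, hu⟩
    rcases eq_or_ne c 0 with rfl | hc
    · exact ⟨1, one_pos, by rw [zero_smul, smul_zero, modular_zero]; simp⟩
    · have hc' : 0 < |c| := abs_pos.2 hc
      refine ⟨α / |c|, by positivity, ?_⟩
      rw [smul_smul, D.modular_congr u (d := α)]
      · exact hu
      · rw [abs_mul, abs_div, abs_abs, div_mul_cancel₀ _ hc'.ne']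

/-- The Musielak-Orlicz space `L^H(Ω; F)`; `L^H(Ω)` is the case `F = ℝ`. -/
def LH (F : Type*) [NormedAddCommGroup F] [NormedSpace ℝ F] : Type _ := D.lhSubmodule F

instance : AddCommGroup (D.LH F) := inferInstanceAs (AddCommGroup (D.lhSubmodule F))
instance : Module ℝ (D.LH F) := inferInstanceAs (Module ℝ (D.lhSubmodule F))

variable {D} in
/-- The underlying class of measurable functions. -/
def LH.toM (u : D.LH F) : D.M F := u.1

/-- The Luxemburg norm `‖u‖_H = inf {τ > 0 : ρ_H(u/τ) ≤ 1}`. -/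
instance : Norm (D.LH F) := ⟨fun u => sInf {τ : ℝ | 0 < τ ∧ D.modular (τ⁻¹ • u.toM) ≤ 1}⟩

theorem norm_def (u : D.LH F) :
    ‖u‖ = sInf {τ : ℝ | 0 < τ ∧ D.modular (τ⁻¹ • u.toM) ≤ 1} := rfl

theorem lux_bddBelow (u : D.LH F) :
    BddBelow {τ : ℝ | 0 < τ ∧ D.modular (τ⁻¹ • u.toM) ≤ 1} := ⟨0, fun _ h => h.1.le⟩

theorem lux_nonempty (u : D.LH F) :
    {τ : ℝ | 0 < τ ∧ D.modular (τ⁻¹ • u.toM) ≤ 1}.Nonempty := by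
  obtain ⟨α, hα, hu⟩ := u.2
  set R : ℝ := (D.modular (α • u.toM)).toReal with hR
  have hR0 : 0 ≤ R := ENNReal.toReal_nonneg
  refine ⟨(R + 1) / α, by positivity, ?_⟩
  have h := D.modular_smul_le (α • u.toM) (a := (R + 1)⁻¹) (by positivity)
    (inv_le_one_of_one_le₀ (by linarith))
  rw [smul_smul] at h
  rw [inv_div, show α / (R + 1) = (R + 1)⁻¹ * α by rw [div_eq_mul_inv, mul_comm]]
  refine h.trans ?_
  rw [← ENNReal.ofReal_toReal (a := D.modular (α • u.toM)) hu.ne, ← hR,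
    ← ENNReal.ofReal_mul (by positivity), ← ENNReal.ofReal_one]
  refine ENNReal.ofReal_le_ofReal ?_
  rw [inv_mul_le_iff₀ (by positivity)]
  linarith

theorem lh_norm_nonneg (u : D.LH F) : 0 ≤ ‖u‖ := Real.sInf_nonneg fun _ h => h.1.le

theorem lh_norm_le (u : D.LH F) {τ : ℝ} (h0 : 0 < τ) (h : D.modular (τ⁻¹ • u.toM) ≤ 1) :
    ‖u‖ ≤ τ := csInf_le (D.lux_bddBelow u) ⟨h0, h⟩

theorem lh_exists_lt (u : D.LH F) {ε : ℝ} (hε : 0 < ε) :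
    ∃ τ : ℝ, 0 < τ ∧ D.modular (τ⁻¹ • u.toM) ≤ 1 ∧ τ < ‖u‖ + ε := by
  obtain ⟨τ, hτ, h⟩ := exists_lt_of_csInf_lt (D.lux_nonempty u)
    (show sInf _ < ‖u‖ + ε from lt_add_of_pos_right _ hε)
  exact ⟨τ, hτ.1, hτ.2, h⟩

theorem lh_norm_add_le (u v : D.LH F) : ‖u + v‖ ≤ ‖u‖ + ‖v‖ := by
  refine le_of_forall_pos_le_add fun ε hε => ?_
  obtain ⟨τ, hτ, hu, hτ'⟩ := D.lh_exists_lt u (half_pos hε)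
  obtain ⟨σ, hσ, hv, hσ'⟩ := D.lh_exists_lt v (half_pos hε)
  have hs : 0 < τ + σ := by positivity
  refine (D.lh_norm_le (u + v) hs ?_).trans (by linarith)
  have h := D.modular_convex (τ⁻¹ • u.toM) (σ⁻¹ • v.toM) (a := τ / (τ + σ)) (b := σ / (τ + σ))
    (by positivity) (by positivity) (by field_simp)
  rw [smul_smul, smul_smul, show τ / (τ + σ) * τ⁻¹ = (τ + σ)⁻¹ by field_simp,
    show σ / (τ + σ) * σ⁻¹ = (τ + σ)⁻¹ by field_simp, ← smul_add] at h
  refine h.trans ?_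
  calc _ ≤ ENNReal.ofReal (τ / (τ + σ)) * 1 + ENNReal.ofReal (σ / (τ + σ)) * 1 := by gcongr
    _ = 1 := by
      rw [mul_one, mul_one, ← ENNReal.ofReal_add (by positivity) (by positivity), ← add_div,
        div_self hs.ne', ENNReal.ofReal_one]

theorem lh_norm_smul_le (u : D.LH F) {c : ℝ} (hc : c ≠ 0) : ‖c • u‖ ≤ |c| * ‖u‖ := by
  have hc' : 0 < |c| := abs_pos.2 hc
  refine le_of_forall_pos_le_add fun ε hε => ?_
  obtain ⟨τ, hτ, hu, hτ'⟩ := D.lh_exists_lt u (ε := ε / |c|) (by positivity)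
  refine (D.lh_norm_le (c • u) (τ := |c| * τ) (by positivity) ?_).trans ?_
  · change D.modular ((|c| * τ)⁻¹ • (c • u.toM)) ≤ 1
    rw [smul_smul, D.modular_congr u.toM (d := τ⁻¹)]
    · exact hu
    · rw [abs_mul, abs_inv, abs_mul, abs_abs, abs_inv]
      field_simp
  · have := mul_lt_mul_of_pos_left hτ' hc'
    rw [mul_add, mul_div_cancel₀ _ hc'.ne'] at this
    exact this.le

theorem lh_norm_zero : ‖(0 : D.LH F)‖ = 0 := by
  refine le_antisymm (le_of_forall_pos_le_add fun ε hε => ?_) (D.lh_norm_nonneg _)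
  rw [zero_add]
  refine D.lh_norm_le _ hε ?_
  change D.modular (ε⁻¹ • (0 : D.M F)) ≤ 1
  rw [smul_zero, modular_zero]
  exact zero_le_one

theorem lh_norm_smul (c : ℝ) (u : D.LH F) : ‖c • u‖ = ‖c‖ * ‖u‖ := by
  rcases eq_or_ne c 0 with rfl | hc
  · rw [zero_smul, lh_norm_zero, norm_zero, zero_mul]
  refine le_antisymm (D.lh_norm_smul_le u hc) ?_
  have h := D.lh_norm_smul_le (c • u) (inv_ne_zero hc)
  rw [smul_smul, inv_mul_cancel₀ hc, one_smul, abs_inv] at h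
  rwa [Real.norm_eq_abs, ← le_inv_mul_iff₀ (abs_pos.2 hc)]

theorem lh_norm_eq_zero (u : D.LH F) (h : ‖u‖ = 0) : u = 0 := by
  refine Subtype.ext (D.modular_eq_zero (u := u.toM) ?_)
  refine le_antisymm (le_of_forall_pos_le_add fun ε hε => ?_) zero_le
  rw [zero_add]
  rcases eq_or_ne ε ⊤ with rfl | hε'
  · exact le_top
  have hδ : 0 < min ε.toReal 1 := lt_min (ENNReal.toReal_pos hε.ne' hε') one_pos
  obtain ⟨τ, hτ, hu, hτ'⟩ := D.lh_exists_lt u hδ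
  rw [h, zero_add, lt_min_iff] at hτ'
  have h2 := D.modular_smul_le (τ⁻¹ • u.toM) hτ.le hτ'.2.le
  rw [smul_smul, mul_inv_cancel₀ hτ.ne', one_smul] at h2
  calc _ ≤ ENNReal.ofReal τ * 1 := h2.trans (by gcongr)
    _ ≤ ε := by rw [mul_one]; exact ENNReal.ofReal_le_of_le_toReal hτ'.1.le

theorem lhCore : NormedSpace.Core ℝ (D.LH F) where
  norm_nonneg := D.lh_norm_nonneg
  norm_smul := D.lh_norm_smul
  norm_triangle := D.lh_norm_add_le
  norm_eq_zero_iff u := ⟨D.lh_norm_eq_zero u, fun h => by rw [h, lh_norm_zero]⟩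

instance : NormedAddCommGroup (D.LH F) := NormedAddCommGroup.ofCore D.lhCore
instance : NormedSpace ℝ (D.LH F) := NormedSpace.ofCore D.lhCore

end Data

variable {N : ℕ}

theorem IsTestFunction.integrable_mul {Ω : Set (Euc N)} {f ψ : Euc N → ℝ}
    {K : Set (Euc N)} (hK : IsCompact K) (hf : IntegrableOn f K)
    (hψ : Continuous ψ) (hs : Function.support ψ ⊆ K) :
    IntegrableOn (fun x => f x * ψ x) Ω := by
  have h : IntegrableOn (fun x => f x * ψ x) K := hf.mul_continuousOn hψ.continuousOn hK
  have hsub : Function.support (fun x => f x * ψ x) ⊆ K := fun x hx =>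
    hs (fun h0 => hx (by simp [h0]))
  exact ((integrableOn_iff_integrable_of_support_subset hsub).1 h).integrableOn

theorem IsTestFunction.integrable_pair {Ω : Set (Euc N)} {φ : Euc N → ℝ}
    (hφ : IsTestFunction Ω φ) {u : Euc N → ℝ} {G : Euc N → Euc N} (h : HasWeakGradient Ω u G)
    (i : Fin N) :
    IntegrableOn (fun x => u x * fderiv ℝ φ x (EuclideanSpace.single i 1)) Ω ∧
      IntegrableOn (fun x => G x i * φ x) Ω := by
  have hK : IsCompact (tsupport φ) := hφ.hasCompactSupport
  constructor
  · refine integrable_mul hK (h.locInt _ hφ.tsupport_subset hK) ?_ ?_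
    · exact (hφ.smooth.continuous_fderiv (by simp)).clm_apply continuous_const
    · intro x hx
      refine support_fderiv_subset ℝ (fun h0 => hx ?_)
      simp [h0]
  · refine integrable_mul hK ?_ hφ.smooth.continuous (subset_tsupport φ)
    exact (EuclideanSpace.proj (𝕜 := ℝ) i).integrable_comp
      (h.locInt_grad _ hφ.tsupport_subset hK)

theorem HasWeakGradient.congr {Ω : Set (Euc N)} {u v : Euc N → ℝ} {G G' : Euc N → Euc N}
    (h : HasWeakGradient Ω u G) (hu : v =ᵐ[volume.restrict Ω] u)
    (hG : G' =ᵐ[volume.restrict Ω] G) : HasWeakGradient Ω v G' where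
  locInt K hK hc := (h.locInt K hK hc).congr (ae_restrict_of_ae_restrict_of_subset hK hu.symm)
  locInt_grad K hK hc :=
    (h.locInt_grad K hK hc).congr (ae_restrict_of_ae_restrict_of_subset hK hG.symm)
  integral_eq φ hφ i := by
    have h1 : ∫ x in Ω, v x * fderiv ℝ φ x (EuclideanSpace.single i 1)
        = ∫ x in Ω, u x * fderiv ℝ φ x (EuclideanSpace.single i 1) :=
      integral_congr_ae (hu.mono fun x hx => by simp only [hx])
    have h2 : ∫ x in Ω, G' x i * φ x = ∫ x in Ω, G x i * φ x :=
      integral_congr_ae (hG.mono fun x hx => by simp only [hx])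
    rw [h1, h2, h.integral_eq φ hφ i]

theorem HasWeakGradient.add {Ω : Set (Euc N)} {u v : Euc N → ℝ} {G G' : Euc N → Euc N}
    (h : HasWeakGradient Ω u G) (h' : HasWeakGradient Ω v G') :
    HasWeakGradient Ω (u + v) (G + G') where
  locInt K hK hc := (h.locInt K hK hc).add (h'.locInt K hK hc)
  locInt_grad K hK hc := (h.locInt_grad K hK hc).add (h'.locInt_grad K hK hc)
  integral_eq φ hφ i := by
    obtain ⟨a1, a2⟩ := hφ.integrable_pair h i
    obtain ⟨b1, b2⟩ := hφ.integrable_pair h' i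
    simp only [Pi.add_apply, PiLp.add_apply, add_mul]
    rw [integral_add a1 b1, integral_add a2 b2, h.integral_eq φ hφ i, h'.integral_eq φ hφ i]
    ring

theorem HasWeakGradient.smul {Ω : Set (Euc N)} {u : Euc N → ℝ} {G : Euc N → Euc N}
    (h : HasWeakGradient Ω u G) (c : ℝ) : HasWeakGradient Ω (c • u) (c • G) where
  locInt K hK hc := (h.locInt K hK hc).smul c
  locInt_grad K hK hc := (h.locInt_grad K hK hc).smul c
  integral_eq φ hφ i := by
    simp only [Pi.smul_apply, PiLp.smul_apply, smul_eq_mul, mul_assoc]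
    rw [integral_const_mul, integral_const_mul, h.integral_eq φ hφ i]
    ring

theorem HasWeakGradient.zero (Ω : Set (Euc N)) : HasWeakGradient Ω 0 0 where
  locInt _ _ _ := integrableOn_zero
  locInt_grad _ _ _ := integrableOn_zero
  integral_eq φ hφ i := by simp

namespace Data

variable (D : Data N)

/-- The Musielak-Orlicz Sobolev space `W^{1,H}(Ω)` of all `u ∈ L^H(Ω)` whose weak gradient
exists and lies in `L^H(Ω; ℝ^N)`. An element is stored as the pair `(u, ∇u)`; the second entry is
determined by the first, as weak gradients are unique almost everywhere. The norm inherited from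
the `ℓ¹`-product is `‖u‖_{1,H} = ‖u‖_H + ‖∇u‖_H`. -/
def W1H : Submodule ℝ (WithLp 1 (D.LH ℝ × D.LH (Euc N))) where
  carrier := {w | HasWeakGradient D.Ω w.fst.toM w.snd.toM}
  zero_mem' := (HasWeakGradient.zero D.Ω).congr AEEqFun.coeFn_zero AEEqFun.coeFn_zero
  add_mem' {v w} hv hw := (HasWeakGradient.add hv hw).congr
    (AEEqFun.coeFn_add v.fst.toM w.fst.toM) (AEEqFun.coeFn_add v.snd.toM w.snd.toM)
  smul_mem' c {w} hw := (HasWeakGradient.smul hw c).congr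
    (AEEqFun.coeFn_smul c w.fst.toM) (AEEqFun.coeFn_smul c w.snd.toM)

/-- The embedding `W^{1,H}(Ω) → L^H(Ω)`, `u ↦ u`. -/
def embed : D.W1H →L[ℝ] D.LH ℝ :=
  (WithLp.fstL 1 ℝ (D.LH ℝ) (D.LH (Euc N))).comp D.W1H.subtypeL

/-- The gradient `W^{1,H}(Ω) → L^H(Ω; ℝ^N)`, `u ↦ ∇u`. -/
def grad : D.W1H →L[ℝ] D.LH (Euc N) :=
  (WithLp.sndL 1 ℝ (D.LH ℝ) (D.LH (Euc N))).comp D.W1H.subtypeL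

theorem norm_W1H (w : D.W1H) : ‖w‖ = ‖D.embed w‖ + ‖D.grad w‖ :=
  WithLp.prod_norm_eq_of_L1 w.1

/-- The elements of `W^{1,H}(Ω)` that belong to `C_0^∞(Ω)`. -/
def testSubmodule : Submodule ℝ D.W1H where
  carrier := {w | ∃ φ : Euc N → ℝ, IsTestFunction D.Ω φ ∧
    (D.embed w).toM =ᵐ[volume.restrict D.Ω] φ}
  zero_mem' := ⟨0, ⟨contDiff_const, HasCompactSupport.zero, by simp [tsupport]⟩,
    AEEqFun.coeFn_zero⟩
  add_mem' := by
    rintro v w ⟨φ, hφ, hv⟩ ⟨ψ, hψ, hw⟩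
    refine ⟨φ + ψ, ⟨hφ.smooth.add hψ.smooth, hφ.hasCompactSupport.add hψ.hasCompactSupport,
      (tsupport_add φ ψ).trans (union_subset hφ.tsupport_subset hψ.tsupport_subset)⟩, ?_⟩
    exact (AEEqFun.coeFn_add (D.embed v).toM (D.embed w).toM).trans (hv.add hw)
  smul_mem' := by
    rintro c w ⟨φ, hφ, hw⟩
    refine ⟨c • φ, ⟨hφ.smooth.const_smul c, hφ.hasCompactSupport.smul_left (f := fun _ => c),
      (closure_mono (Function.support_const_smul_subset c φ)).trans hφ.tsupport_subset⟩, ?_⟩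
    exact (AEEqFun.coeFn_smul c (D.embed w).toM).trans (hw.const_smul c)

/-- `W_0^{1,H}(Ω)`, the closure of `C_0^∞(Ω)` in `W^{1,H}(Ω)`. -/
def W01H : Submodule ℝ D.W1H := D.testSubmodule.topologicalClosure

/-- The map `u ↦ ‖∇u‖_H` on `W_0^{1,H}(Ω)`. -/
def gradSeminorm : Seminorm ℝ D.W01H :=
  (normSeminorm ℝ (D.LH (Euc N))).comp (D.grad.toLinearMap.comp D.W01H.subtype)

end Data

end DoublePhase

end

/-!
The inclusion `W^{1,H} → L^H` is a norm limit of operators of finite rank that replace `u` by local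
averages of `u`; no Sobolev extension operator is needed.

A Lipschitz domain has the uniform cone property (`HasLipschitzBoundary.hasUniformCone`): near each
point of the closure, one truncated cone with axis `e` can be attached to every point of `Ω` without
leaving `Ω`. At scale `ε`, cut a neighbourhood into pieces of diameter comparable to `ε` and shift
each piece by `ε e`, so that a ball of radius comparable to `ε` is visible from all points `x` of the
piece along segments inside `Ω`. Integrating the gradient along these segments bounds the mean
oscillation of `u` about `u(x)` over that ball by the convolution of `|∇u|` with the Riesz kernel
`|y|^{1-N}` truncated at `|y| < 2ε`. For smooth functions this is
`lintegral_enorm_sub_le_truncRiesz`; mollification and Fatou's lemma give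
`lintegral_oscillation_rpow_le` for weakly differentiable `u`. The cone property is stable under the
mollification, because a whole ball `B(x,d) ⊆ Ω` is transported into `Ω` along with `x`.

Young's inequality (`lintegral_convolution_rpow_le`) maps `L^{p₀}` to `L^{q₀}` with the constant
`‖|y|^{1-N} 1_{|y|<2ε}‖_{L^s}`, `1/p₀ + 1/s = 1 + 1/q₀`, which tends to zero with `ε` exactly when
`q₀ < p₀^*`. By continuity of the exponents, such `p₀ ≤ p` and `q ≤ q₀` exist near each point of the
compact closure. Hence `u` minus the step function of its averages is small in `L^{q₀}`, and
therefore in `L^H` (`exists_local_approx`), uniformly on the unit ball of `W^{1,H}`; a compactness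
induction makes this global (`exists_approx`). Since `L^H` is complete, the inclusion is compact.

The approximating operators factor through `L¹(Ω)`, so the same statement with error `1/2` reads
`‖u‖_H ≤ (‖u‖_H + ‖∇u‖_H)/2 + C ‖u‖_{L¹}`. The `L¹` Poincaré inequality for test functions,
extended to the closure by continuity, then gives `‖u‖_H ≤ C ‖∇u‖_H` on `W_0^{1,H}`, and with it the
equivalence of the norms. Injectivity is uniqueness of the weak gradient.
-/

noncomputable section

namespace DoublePhase

open Filter Topology

/-! ### Truncated Riesz kernels and Young's inequality -/

section Kernel
variable {N : ℕ}

/-- Integrals of `‖y‖^{-b}`, `b < N`, over shrinking balls tend to zero: this locates the critical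
exponent in the compactness argument. -/
theorem tendsto_lintegral_ball_norm_rpow (hN : 1 ≤ N) {b : ℝ} (hb : b < N) :
    Tendsto (fun L : ℝ => ∫⁻ y in Metric.ball (0 : Euc N) L, ENNReal.ofReal (‖y‖ ^ (-b)))
      (𝓝[>] 0) (𝓝 0) := by
  have hint : IntegrableOn (fun y : Euc N => ‖y‖ ^ (-b)) (Metric.ball 0 1) := by
    refine integrableOn_ball_of_norm_le_rpow (C := 1) (α := b) (by simpa using hN)
      (by simpa using hb) (Eventually.of_forall fun y => ?_) ?_
    · rw [Real.norm_of_nonneg (by positivity), one_mul]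
    · exact (measurable_norm.pow_const _).aestronglyMeasurable
  have hfin : ∫⁻ y, ENNReal.ofReal (‖y‖ ^ (-b)) ∂(volume.restrict (Metric.ball (0 : Euc N) 1)) ≠ ⊤ := by
    refine ne_of_lt (lt_of_le_of_lt (lintegral_mono fun y => ?_) hint.2)
    rw [Real.enorm_of_nonneg (by positivity)]
  have hvol : Tendsto (fun L : ℝ => volume.restrict (Metric.ball (0 : Euc N) 1)
      (Metric.ball (0 : Euc N) L)) (𝓝[>] 0) (𝓝 0) := by
    have h0 : Tendsto (fun L : ℝ => ENNReal.ofReal L ^ N * volume (Metric.ball (0 : Euc N) 1))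
        (𝓝[>] 0) (𝓝 0) := by
      have h1 : Tendsto (fun L : ℝ => ENNReal.ofReal L ^ N) (𝓝[>] 0) (𝓝 0) := by
        have h2 : Tendsto (fun L : ℝ => ENNReal.ofReal L ^ N) (𝓝 0) (𝓝 (ENNReal.ofReal 0 ^ N)) :=
          ((ENNReal.continuous_pow N).comp ENNReal.continuous_ofReal).tendsto 0
        rw [ENNReal.ofReal_zero, zero_pow (by omega)] at h2
        exact h2.mono_left nhdsWithin_le_nhds
      have h3 := ENNReal.Tendsto.mul_const (b := volume (Metric.ball (0 : Euc N) 1)) h1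
        (Or.inr measure_ball_lt_top.ne)
      rwa [zero_mul] at h3
    refine tendsto_of_tendsto_of_tendsto_of_le_of_le' tendsto_const_nhds h0
      (Eventually.of_forall fun _ => zero_le) ?_
    filter_upwards [self_mem_nhdsWithin] with L hL
    have : Nontrivial (Euc N) := by
      have : Nonempty (Fin N) := ⟨⟨0, by omega⟩⟩
      infer_instance
    refine (Measure.restrict_apply_le _ _).trans ?_
    rw [Measure.addHaar_ball volume _ (le_of_lt hL)]
    simp [ENNReal.ofReal_pow (le_of_lt hL)]
  have h := tendsto_setLIntegral_zero hfin hvol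
  refine h.congr' ?_
  filter_upwards [Ioo_mem_nhdsGT (zero_lt_one' ℝ)] with L hL
  rw [Measure.restrict_restrict measurableSet_ball,
    inter_eq_left.2 (Metric.ball_subset_ball hL.2.le)]

/-- Young's inequality for the correlation `x ↦ ∫ k(y) g(x + y) dy`, by Hölder's inequality with the
three factors `(k^s g^p)^{1/r}`, `(k^s)^{1/s - 1/r}` and `(g^p)^{1/p - 1/r}`. -/
theorem lintegral_convolution_rpow_le {k g : Euc N → ℝ≥0∞} (hk : Measurable k)
    (hg : Measurable g) {p r s : ℝ} (hp : 1 ≤ p) (hs : 1 ≤ s) (hr : 0 < r)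
    (h : 1 / p + 1 / s = 1 + 1 / r) :
    ∫⁻ x, (∫⁻ y, k y * g (x + y)) ^ r ≤
      (∫⁻ y, k y ^ s) ^ (r / s) * (∫⁻ y, g y ^ p) ^ (r / p) := by
  have hp0 : 0 < p := by linarith
  have hs0 : 0 < s := by linarith
  have e1 : 1 / s - 1 / r = 1 - 1 / p := by linarith
  have e2 : 1 / p - 1 / r = 1 - 1 / s := by linarith
  have n1 : 0 ≤ 1 / s - 1 / r := by
    rw [e1]; exact sub_nonneg.2 ((div_le_one hp0).2 hp)
  have n2 : 0 ≤ 1 / p - 1 / r := by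
    rw [e2]; exact sub_nonneg.2 ((div_le_one hs0).2 hs)
  have m1 : 0 ≤ r / s - 1 := by
    have := mul_nonneg hr.le n1
    have e : r * (1 / s - 1 / r) = r / s - 1 := by field_simp
    linarith
  have m2 : 0 ≤ r / p - 1 := by
    have := mul_nonneg hr.le n2
    have e : r * (1 / p - 1 / r) = r / p - 1 := by field_simp
    linarith
  set K := ∫⁻ y, k y ^ s
  set P := ∫⁻ y, g y ^ p
  have hpt : ∀ x, (∫⁻ y, k y * g (x + y)) ^ r ≤
      (∫⁻ y, k y ^ s * g (x + y) ^ p) * (K ^ (r / s - 1) * P ^ (r / p - 1)) := by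
    intro x
    have hgx : Measurable fun y => g (x + y) := hg.comp (measurable_const_add x)
    have hH := ENNReal.lintegral_prod_norm_pow_le (μ := (volume : Measure (Euc N)))
      (Finset.univ : Finset (Fin 3))
      (f := ![fun y => k y ^ s * g (x + y) ^ p, fun y => k y ^ s, fun y => g (x + y) ^ p])
      (by
        intro i _
        fin_cases i
        · exact ((hk.pow_const s).mul (hgx.pow_const p)).aemeasurable
        · exact (hk.pow_const s).aemeasurable
        · exact (hgx.pow_const p).aemeasurable)
      (p := ![1 / r, 1 / s - 1 / r, 1 / p - 1 / r])
      (by simp only [Fin.sum_univ_three, Matrix.cons_val]; linarith)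
      (by
        intro i _
        fin_cases i
        · simp [hr.le]
        · exact n1
        · exact n2)
    simp only [Fin.prod_univ_three, Matrix.cons_val] at hH
    have hP : ∫⁻ y, g (x + y) ^ p = P := lintegral_add_left_eq_self (fun y => g y ^ p) x
    rw [hP] at hH
    have hle : ∫⁻ y, k y * g (x + y) ≤
        (∫⁻ y, k y ^ s * g (x + y) ^ p) ^ (1 / r) * K ^ (1 / s - 1 / r) * P ^ (1 / p - 1 / r) := by
      refine (lintegral_mono fun y => le_of_eq ?_).trans hH
      rw [ENNReal.mul_rpow_of_nonneg _ _ (by positivity), ← ENNReal.rpow_mul, ← ENNReal.rpow_mul,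
        ← ENNReal.rpow_mul, ← ENNReal.rpow_mul]
      calc k y * g (x + y) = k y ^ (s * (1 / r) + s * (1 / s - 1 / r)) *
            g (x + y) ^ (p * (1 / r) + p * (1 / p - 1 / r)) := by
              rw [show s * (1 / r) + s * (1 / s - 1 / r) = 1 by field_simp; ring,
                show p * (1 / r) + p * (1 / p - 1 / r) = 1 by field_simp; ring, ENNReal.rpow_one,
                ENNReal.rpow_one]
        _ = _ := by
              rw [ENNReal.rpow_add_of_nonneg _ _ (by positivity) (mul_nonneg hs0.le n1),
                ENNReal.rpow_add_of_nonneg _ _ (by positivity) (mul_nonneg hp0.le n2)]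
              ring
    refine (ENNReal.rpow_le_rpow hle hr.le).trans (le_of_eq ?_)
    rw [ENNReal.mul_rpow_of_nonneg _ _ hr.le, ENNReal.mul_rpow_of_nonneg _ _ hr.le,
      ← ENNReal.rpow_mul, ← ENNReal.rpow_mul, ← ENNReal.rpow_mul,
      show 1 / r * r = 1 by field_simp, show (1 / s - 1 / r) * r = r / s - 1 by field_simp,
      show (1 / p - 1 / r) * r = r / p - 1 by field_simp, ENNReal.rpow_one, mul_assoc]
  have hmeas : Measurable fun q : Euc N × Euc N => k q.2 ^ s * g (q.1 + q.2) ^ p :=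
    ((hk.comp measurable_snd).pow_const s).mul
      ((hg.comp (measurable_fst.add measurable_snd)).pow_const p)
  calc _ ≤ ∫⁻ x, (∫⁻ y, k y ^ s * g (x + y) ^ p) * (K ^ (r / s - 1) * P ^ (r / p - 1)) :=
        lintegral_mono hpt
    _ = (∫⁻ x, ∫⁻ y, k y ^ s * g (x + y) ^ p) * (K ^ (r / s - 1) * P ^ (r / p - 1)) :=
        lintegral_mul_const _ hmeas.lintegral_prod_right'
    _ = (K * P) * (K ^ (r / s - 1) * P ^ (r / p - 1)) := by
        congr 1
        rw [lintegral_lintegral_swap (f := fun x y => k y ^ s * g (x + y) ^ p) hmeas.aemeasurable]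
        have : ∀ y, ∫⁻ x, k y ^ s * g (x + y) ^ p = k y ^ s * P := fun y => by
          rw [lintegral_const_mul _ (show Measurable fun x => g (x + y) ^ p from
            (hg.comp (measurable_add_const y)).pow_const p),
            lintegral_add_right_eq_self (fun x => g x ^ p) y]
        simp_rw [this]
        exact lintegral_mul_const _ (hk.pow_const s)
    _ = (K ^ (1 : ℝ) * K ^ (r / s - 1)) * (P ^ (1 : ℝ) * P ^ (r / p - 1)) := by
        rw [ENNReal.rpow_one, ENNReal.rpow_one]; ring
    _ = _ := by
        rw [← ENNReal.rpow_add_of_nonneg _ _ zero_le_one m1,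
          ← ENNReal.rpow_add_of_nonneg _ _ zero_le_one m2]
        congr 2 <;> ring

/-- The Riesz kernel `L^N |y|^{1-N}`, truncated to the ball `|y| < L`. The factor `L^N` compensates the
volume of the balls over which oscillations are averaged. -/
def truncRiesz (N : ℕ) (L : ℝ) (y : Euc N) : ℝ≥0∞ :=
  ENNReal.ofReal (L ^ N) *
    (Metric.ball (0 : Euc N) L).indicator (fun y => ENNReal.ofReal (‖y‖ ^ (-((N : ℝ) - 1)))) y

theorem measurable_truncRiesz (L : ℝ) : Measurable (truncRiesz N L) :=
  ((measurable_norm.pow_const _).ennreal_ofReal.indicator measurableSet_ball).const_mul _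

theorem lintegral_truncRiesz_rpow (L : ℝ) {s : ℝ} (hs : 0 < s) :
    ∫⁻ y, truncRiesz N L y ^ s = ENNReal.ofReal (L ^ N) ^ s *
      ∫⁻ y in Metric.ball (0 : Euc N) L, ENNReal.ofReal (‖y‖ ^ (-(((N : ℝ) - 1) * s))) := by
  rw [← lintegral_indicator measurableSet_ball, ← lintegral_const_mul _
    ((measurable_norm.pow_const _).ennreal_ofReal.indicator measurableSet_ball)]
  refine lintegral_congr fun y => ?_
  rw [truncRiesz, ENNReal.mul_rpow_of_nonneg _ _ hs.le]
  congr 1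
  by_cases hy : y ∈ Metric.ball (0 : Euc N) L
  · rw [indicator_of_mem hy, indicator_of_mem hy, ENNReal.ofReal_rpow_of_nonneg (by positivity) hs.le,
      ← Real.rpow_mul (norm_nonneg _), neg_mul]
  · rw [indicator_of_notMem hy, indicator_of_notMem hy, ENNReal.zero_rpow_of_pos hs]

theorem lintegral_comp_smul_pos {t : ℝ} (ht : 0 < t) {f : Euc N → ℝ≥0∞} (hf : Measurable f) :
    ∫⁻ w, f (t • w) = ENNReal.ofReal (t ^ (-(N : ℝ))) * ∫⁻ y, f y := by
  rw [← lintegral_map (g := fun w : Euc N => t • w) hf (measurable_const_smul t),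
    Measure.map_addHaar_smul volume ht.ne', lintegral_smul_measure, smul_eq_mul]
  congr 2
  rw [abs_of_pos (by positivity), Real.rpow_neg ht.le]
  simp

/-- The weight with which the value of the gradient at `x + y` enters the integral over all segments
from `x` to points of the ball of radius `L`: the parameter `t` ranges over `t > ‖y‖ / L`. -/
theorem lintegral_rpow_neg_le_truncRiesz (hN : 2 ≤ N) {L : ℝ} (hL : 0 < L) {y : Euc N}
    (hy : y ≠ 0) :
    ∫⁻ t in Icc (0 : ℝ) 1, ENNReal.ofReal L * (ENNReal.ofReal (t ^ (-(N : ℝ))) *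
      (Metric.ball (0 : Euc N) (t * L)).indicator 1 y) ≤ truncRiesz N L y := by
  have hy0 : 0 < ‖y‖ := norm_pos_iff.2 hy
  have hN' : (2 : ℝ) ≤ N := by exact_mod_cast hN
  by_cases hyL : ‖y‖ < L
  · have ha : 0 < ‖y‖ / L := by positivity
    calc _ ≤ ∫⁻ t, (Ioi (‖y‖ / L)).indicator
            (fun t : ℝ => ENNReal.ofReal L * ENNReal.ofReal (t ^ (-(N : ℝ)))) t := by
          refine (lintegral_mono fun t => ?_).trans (setLIntegral_le_lintegral _ _)
          by_cases ht : ‖y‖ < t * L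
          · have : t ∈ Ioi (‖y‖ / L) := (div_lt_iff₀ hL).2 ht
            rw [indicator_of_mem this, indicator_of_mem (by simpa using ht)]
            simp
          · rw [indicator_of_notMem (by simpa using ht)]
            simp
      _ = ENNReal.ofReal L * ∫⁻ t in Ioi (‖y‖ / L), ENNReal.ofReal (t ^ (-(N : ℝ))) := by
          rw [lintegral_indicator measurableSet_Ioi,
            lintegral_const_mul _ (show Measurable fun t : ℝ => ENNReal.ofReal (t ^ (-(N : ℝ))) from
              (measurable_id.pow_const _).ennreal_ofReal)]
      _ = ENNReal.ofReal L * ENNReal.ofReal (-(‖y‖ / L) ^ (-(N : ℝ) + 1) / (-(N : ℝ) + 1)) := by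
          rw [← integral_Ioi_rpow_of_lt (by linarith) ha, ofReal_integral_eq_lintegral_ofReal
            (integrableOn_Ioi_rpow_of_lt (by linarith) ha)]
          filter_upwards [ae_restrict_mem measurableSet_Ioi] with t ht
          have : 0 < t := ha.trans ht
          positivity
      _ ≤ truncRiesz N L y := by
          rw [truncRiesz, indicator_of_mem (by simpa using hyL), ← ENNReal.ofReal_mul hL.le,
            ← ENNReal.ofReal_mul (by positivity)]
          refine ENNReal.ofReal_le_ofReal ?_
          have h1 : -(‖y‖ / L) ^ (-(N : ℝ) + 1) / (-(N : ℝ) + 1) ≤ (‖y‖ / L) ^ (-(N : ℝ) + 1) := by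
            rw [← neg_div_neg_eq, neg_neg]
            exact div_le_self (by positivity) (by linarith)
          refine (mul_le_mul_of_nonneg_left h1 hL.le).trans (le_of_eq ?_)
          rw [Real.div_rpow hy0.le hL.le, show -((N : ℝ) - 1) = -(N : ℝ) + 1 by ring,
            ← Real.rpow_natCast L N, div_eq_mul_inv, ← Real.rpow_neg hL.le,
            show (N : ℝ) = 1 + -(-(N : ℝ) + 1) by ring, Real.rpow_add hL, Real.rpow_one]
          ring_nf
  · refine le_of_eq_of_le ?_ zero_le
    rw [setLIntegral_congr_fun (g := fun _ => 0) measurableSet_Icc, lintegral_zero]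
    intro t ht
    have : ¬ ‖y‖ < t * L := by
      have := mul_le_mul_of_nonneg_right ht.2 hL.le
      linarith
    simp only
    rw [indicator_of_notMem (by simpa using this)]
    simp

/-- If `g` bounds the gradient of a `C¹` function on all segments joining `x` to `B`, then the
oscillation of the function over `B` about its value at `x` is at most a Riesz potential of `g`. The
segments are parametrized by `z = x + w` and the substitution `y = t w` is made for each `t`. -/
theorem lintegral_enorm_sub_le_truncRiesz (hN : 2 ≤ N) {L : ℝ} (hL : 0 < L) {v : Euc N → ℝ}
    (hv : ContDiff ℝ 1 v) {g : Euc N → ℝ≥0∞} (hg : Measurable g) {x : Euc N} {B : Set (Euc N)}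
    (hBm : MeasurableSet B)
    (hB : B ⊆ Metric.ball x L)
    (hvg : ∀ z ∈ B, ∀ t ∈ Icc (0 : ℝ) 1,
      ‖fderiv ℝ v (x + t • (z - x))‖ₑ ≤ g (x + t • (z - x))) :
    ∫⁻ z in B, ‖v x - v z‖ₑ ≤ ∫⁻ y, truncRiesz N L y * g (x + y) := by
  have hFm : Measurable fun q : Euc N × ℝ => g (x + q.2 • q.1) :=
    hg.comp ((measurable_snd.smul measurable_fst).const_add x)
  have hB1 : MeasurableSet {q : ℝ × Euc N | ‖q.2‖ < q.1 * L} :=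
    measurableSet_lt (measurable_snd.norm) (measurable_fst.mul_const L)
  have step1 : ∀ z ∈ B, ‖v x - v z‖ₑ ≤
      ∫⁻ t in Icc (0 : ℝ) 1, ENNReal.ofReal L * g (x + t • (z - x)) := by
    intro z hz
    have hc : ContDiff ℝ 1 fun t : ℝ => v (x + t • (z - x)) :=
      hv.comp (contDiff_const.add (contDiff_id.smul contDiff_const))
    have h := enorm_sub_le_lintegral_deriv_of_contDiffOn_Icc (a := 0) (b := 1) hc.contDiffOn
      zero_le_one
    simp only [one_smul, zero_smul, add_zero, add_sub_cancel] at h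
    rw [← enorm_neg, neg_sub]
    refine h.trans (setLIntegral_mono' measurableSet_Icc fun t ht => ?_)
    have hd : HasDerivAt (fun t : ℝ => v (x + t • (z - x)))
        (fderiv ℝ v (x + t • (z - x)) (z - x)) t := by
      have h1 : HasDerivAt (fun t : ℝ => x + t • (z - x)) (z - x) t := by
        simpa using ((hasDerivAt_id t).smul_const (z - x)).const_add x
      exact ((hv.differentiable one_ne_zero) _).hasFDerivAt.comp_hasDerivAt t h1
    rw [hd.deriv]
    refine (ContinuousLinearMap.le_opENorm _ _).trans ?_
    rw [mul_comm]
    refine mul_le_mul' ?_ (hvg z hz t ht)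
    have : ‖z - x‖ < L := by simpa [dist_eq_norm] using hB hz
    rw [← ofReal_norm]
    exact ENNReal.ofReal_le_ofReal this.le
  calc ∫⁻ z in B, ‖v x - v z‖ₑ
      ≤ ∫⁻ z in B, ∫⁻ t in Icc (0 : ℝ) 1, ENNReal.ofReal L * g (x + t • (z - x)) :=
        setLIntegral_mono' hBm step1
    _ ≤ ∫⁻ z in Metric.ball x L, ∫⁻ t in Icc (0 : ℝ) 1, ENNReal.ofReal L * g (x + t • (z - x)) :=
        lintegral_mono_set hB
    _ = ∫⁻ w in Metric.ball (0 : Euc N) L, ∫⁻ t in Icc (0 : ℝ) 1,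
          ENNReal.ofReal L * g (x + t • w) := by
        rw [← lintegral_indicator measurableSet_ball, ← lintegral_indicator measurableSet_ball]
        refine Eq.trans ?_ (lintegral_sub_right_eq_self _ x)
        refine lintegral_congr fun z => ?_
        simp only [indicator, Metric.mem_ball, dist_eq_norm, sub_zero]
    _ = ∫⁻ t in Icc (0 : ℝ) 1, ∫⁻ w in Metric.ball (0 : Euc N) L,
          ENNReal.ofReal L * g (x + t • w) :=
        lintegral_lintegral_swap (hFm.const_mul _).aemeasurable
    _ = ∫⁻ t in Icc (0 : ℝ) 1, ∫⁻ y, ENNReal.ofReal L * (ENNReal.ofReal (t ^ (-(N : ℝ))) *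
          (Metric.ball (0 : Euc N) (t * L)).indicator 1 y) * g (x + y) := by
        refine lintegral_congr_ae ?_
        have h0 : ∀ᵐ t ∂(volume.restrict (Icc (0 : ℝ) 1)), t ≠ 0 :=
          ae_restrict_of_ae (Measure.ae_ne volume 0)
        filter_upwards [h0, ae_restrict_mem measurableSet_Icc] with t ht0 ht
        have htp : 0 < t := lt_of_le_of_ne ht.1 (Ne.symm ht0)
        have hm : Measurable fun y => g (x + y) := hg.comp (measurable_const_add x)
        have hm2 : Measurable ((Metric.ball (0 : Euc N) (t * L)).indicator fun y => g (x + y)) :=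
          hm.indicator measurableSet_ball
        rw [lintegral_const_mul _ (show Measurable fun w => g (x + t • w) from
          hg.comp ((measurable_const_smul t).const_add x)),
          ← lintegral_indicator measurableSet_ball]
        have e := lintegral_comp_smul_pos htp hm2
        have e2 : ∀ w, (Metric.ball (0 : Euc N) (t * L)).indicator (fun y => g (x + y)) (t • w)
            = (Metric.ball (0 : Euc N) L).indicator (fun w => g (x + t • w)) w := by
          intro w
          have : ‖t • w‖ < t * L ↔ ‖w‖ < L := by
            rw [norm_smul, Real.norm_of_nonneg htp.le, mul_lt_mul_iff_right₀ htp]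
          simp only [indicator, Metric.mem_ball, dist_zero_right, this]
        simp_rw [e2] at e
        rw [e, ← lintegral_const_mul _ hm2, ← lintegral_const_mul _ (hm2.const_mul _)]
        refine lintegral_congr fun y => ?_
        simp only [indicator]
        split_ifs <;> simp [mul_assoc]
    _ = ∫⁻ y, (∫⁻ t in Icc (0 : ℝ) 1, ENNReal.ofReal L * (ENNReal.ofReal (t ^ (-(N : ℝ))) *
          (Metric.ball (0 : Euc N) (t * L)).indicator 1 y)) * g (x + y) := by
        have hm1 : Measurable fun q : ℝ × Euc N => ENNReal.ofReal L *
            (ENNReal.ofReal (q.1 ^ (-(N : ℝ))) *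
              (Metric.ball (0 : Euc N) (q.1 * L)).indicator 1 q.2) := by
          refine ((measurable_fst.pow_const _).ennreal_ofReal.mul ?_).const_mul _
          have : Measurable ({q : ℝ × Euc N | ‖q.2‖ < q.1 * L}.indicator
            (1 : ℝ × Euc N → ℝ≥0∞)) := measurable_one.indicator hB1
          convert this using 2 with q
          simp [indicator]
        rw [lintegral_lintegral_swap]
        · refine lintegral_congr fun y => ?_
          rw [lintegral_mul_const]
          exact hm1.comp (measurable_id.prodMk measurable_const)
        · exact (hm1.mul (hg.comp (measurable_snd.const_add x))).aemeasurable
    _ ≤ ∫⁻ y, truncRiesz N L y * g (x + y) := by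
        have : Nonempty (Fin N) := ⟨⟨0, by omega⟩⟩
        refine lintegral_mono_ae ?_
        filter_upwards [Measure.ae_ne volume (0 : Euc N)] with y hy
        gcongr
        exact lintegral_rpow_neg_le_truncRiesz hN hL hy

end Kernel

/-! ### Weak gradients and mollification -/

section Mollify
variable {N : ℕ}

theorem IsTestFunction.mono {Ω Ω' : Set (Euc N)} (h : Ω' ⊆ Ω) {φ : Euc N → ℝ}
    (hφ : IsTestFunction Ω' φ) : IsTestFunction Ω φ :=
  ⟨hφ.smooth, hφ.hasCompactSupport, hφ.tsupport_subset.trans h⟩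

theorem IsTestFunction.eq_zero_of_notMem {Ω : Set (Euc N)} {φ : Euc N → ℝ}
    (hφ : IsTestFunction Ω φ) {x : Euc N} (hx : x ∉ Ω) : φ x = 0 :=
  image_eq_zero_of_notMem_tsupport fun h => hx (hφ.tsupport_subset h)

theorem IsTestFunction.fderiv_eq_zero_of_notMem {Ω : Set (Euc N)} {φ : Euc N → ℝ}
    (hφ : IsTestFunction Ω φ) {x : Euc N} (hx : x ∉ Ω) : fderiv ℝ φ x = 0 :=
  Function.notMem_support.1 fun h => hx (hφ.tsupport_subset (support_fderiv_subset ℝ h))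

theorem HasWeakGradient.mono {Ω Ω' : Set (Euc N)} (h : Ω' ⊆ Ω) {u : Euc N → ℝ}
    {G : Euc N → Euc N} (hu : HasWeakGradient Ω u G) : HasWeakGradient Ω' u G where
  locInt K hK hc := hu.locInt K (hK.trans h) hc
  locInt_grad K hK hc := hu.locInt_grad K (hK.trans h) hc
  integral_eq φ hφ i := by
    have h1 := hu.integral_eq φ (hφ.mono h) i
    have key : ∀ f : Euc N → ℝ, (∀ x ∉ Ω', f x = 0) → ∫ x in Ω', f x = ∫ x in Ω, f x :=
      fun f hf => (setIntegral_eq_integral_of_forall_compl_eq_zero hf).trans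
        (setIntegral_eq_integral_of_forall_compl_eq_zero fun x hx => hf x fun hx' => hx (h hx')).symm
    rw [key _ fun x hx => by simp [hφ.fderiv_eq_zero_of_notMem hx],
      key _ fun x hx => by simp [hφ.eq_zero_of_notMem hx], h1]

/-- Integration by parts against the derivative of a test function in an arbitrary direction. -/
theorem HasWeakGradient.integral_fderiv_apply {Ω : Set (Euc N)} {u : Euc N → ℝ}
    {G : Euc N → Euc N} (hu : HasWeakGradient Ω u G) {φ : Euc N → ℝ} (hφ : IsTestFunction Ω φ)
    (w : Euc N) : ∫ x in Ω, u x * fderiv ℝ φ x w = -∫ x in Ω, inner ℝ (G x) w * φ x := by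
  have hw : w = ∑ i, w i • EuclideanSpace.single i (1 : ℝ) := by
    have := (EuclideanSpace.basisFun (Fin N) ℝ).sum_repr w
    simpa using this.symm
  have e1 : ∀ x, u x * fderiv ℝ φ x w =
      ∑ i, w i * (u x * fderiv ℝ φ x (EuclideanSpace.single i 1)) := by
    intro x
    conv_lhs => rw [hw, map_sum, Finset.mul_sum]
    refine Finset.sum_congr rfl fun i _ => ?_
    rw [map_smul, smul_eq_mul]; ring
  have e2 : ∀ x, inner ℝ (G x) w * φ x = ∑ i, w i * (G x i * φ x) := by
    intro x
    rw [PiLp.inner_apply, Finset.sum_mul]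
    refine Finset.sum_congr rfl fun i _ => ?_
    simp; ring
  simp_rw [e1, e2]
  rw [integral_finsetSum _ fun i _ => ((hφ.integrable_pair hu i).1).const_mul _,
    integral_finsetSum _ fun i _ => ((hφ.integrable_pair hu i).2).const_mul _,
    ← Finset.sum_neg_distrib]
  refine Finset.sum_congr rfl fun i _ => ?_
  rw [integral_const_mul, integral_const_mul, hu.integral_eq φ hφ i, mul_neg]

/-- The mollification of `f` by the normalized bump function `φ`. -/
def mollify (φ : ContDiffBump (0 : Euc N)) (f : Euc N → ℝ) : Euc N → ℝ :=
  convolution (φ.normed volume) f (ContinuousLinearMap.lsmul ℝ ℝ) volume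

theorem contDiff_mollify (φ : ContDiffBump (0 : Euc N)) {f : Euc N → ℝ} (hf : Integrable f) :
    ContDiff ℝ 1 (mollify φ f) :=
  (φ.hasCompactSupport_normed (μ := volume)).contDiff_convolution_left _ φ.contDiff_normed
    hf.locallyIntegrable

theorem fderiv_mollify_apply (φ : ContDiffBump (0 : Euc N)) {f : Euc N → ℝ} (hf : Integrable f)
    (y w : Euc N) :
    fderiv ℝ (mollify φ f) y w = ∫ x, f x * fderiv ℝ (φ.normed volume) (y - x) w := by
  have h := (φ.hasCompactSupport_normed (μ := volume)).hasFDerivAt_convolution_right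
    (ContinuousLinearMap.lsmul ℝ ℝ).flip hf.locallyIntegrable (φ.contDiff_normed (n := 1)) y
  rw [convolution_flip] at h
  rw [mollify, h.fderiv, convolution_precompR_apply _ hf.locallyIntegrable
    (φ.hasCompactSupport_normed.fderiv ℝ)
    ((φ.contDiff_normed (n := 1)).continuous_fderiv one_ne_zero)]
  refine integral_congr_ae (Eventually.of_forall fun x => ?_)
  simp [mul_comm]

/-- Where the support of the bump around `y` lies in `Ω`, the gradient of the mollified function is at
most the mollification of `|G|`; here `x ↦ φ(y - x)` serves as a test function. -/
theorem enorm_fderiv_mollify_le (φ : ContDiffBump (0 : Euc N)) {Ω : Set (Euc N)}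
    (hΩ : MeasurableSet Ω) {u : Euc N → ℝ} {G : Euc N → Euc N} (h : HasWeakGradient Ω u G)
    (hu : IntegrableOn u Ω) {y : Euc N} (hy : Metric.closedBall y φ.rOut ⊆ Ω) :
    ‖fderiv ℝ (mollify φ (Ω.indicator u)) y‖ₑ ≤
      ∫⁻ t, ENNReal.ofReal (φ.normed volume t) * Ω.indicator (fun x => ‖G x‖ₑ) (y + t) := by
  set ψ : Euc N → ℝ := fun x => φ.normed volume (y - x)
  have hρ : ContDiff ℝ ∞ (φ.normed volume) := φ.contDiff_normed
  have hψ : IsTestFunction Ω ψ := by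
    have hsupp : tsupport ψ ⊆ Metric.closedBall y φ.rOut := by
      refine closure_minimal (fun x hx => ?_) Metric.isClosed_closedBall
      have : y - x ∈ Function.support (φ.normed volume) := hx
      rw [φ.support_normed_eq] at this
      rw [Metric.mem_closedBall, dist_comm, dist_eq_norm]
      simpa using (Metric.mem_ball.1 this).le
    exact ⟨hρ.comp (contDiff_const.sub contDiff_id),
      (isCompact_closedBall y φ.rOut).of_isClosed_subset (isClosed_tsupport _) hsupp,
      hsupp.trans hy⟩
  have hψ' : ∀ x w, fderiv ℝ ψ x w = -fderiv ℝ (φ.normed volume) (y - x) w := by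
    intro x w
    have h1 : HasFDerivAt (fun x : Euc N => y - x) (-ContinuousLinearMap.id ℝ (Euc N)) x :=
      (hasFDerivAt_id x).const_sub y
    have h2 := ((hρ.differentiable (by simp)) (y - x)).hasFDerivAt.comp x h1
    rw [show ψ = φ.normed volume ∘ HSub.hSub y from rfl, h2.fderiv]
    simp
  refine ContinuousLinearMap.opENorm_le_bound _ fun w => ?_
  rw [fderiv_mollify_apply φ (hu.integrable_indicator hΩ)]
  have e : ∫ x, Ω.indicator u x * fderiv ℝ (φ.normed volume) (y - x) w =
      ∫ x in Ω, inner ℝ (G x) w * ψ x := by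
    have h3 := h.integral_fderiv_apply hψ w
    simp_rw [hψ', mul_neg] at h3
    rw [integral_neg, neg_inj] at h3
    rw [← h3, ← integral_indicator hΩ]
    refine integral_congr_ae (Eventually.of_forall fun x => ?_)
    by_cases hx : x ∈ Ω <;> simp [hx]
  rw [e]
  calc _ ≤ ∫⁻ x in Ω, ‖inner ℝ (G x) w * ψ x‖ₑ := enorm_integral_le_lintegral_enorm _
    _ ≤ ∫⁻ x in Ω, (ENNReal.ofReal (φ.normed volume (y - x)) * ‖G x‖ₑ) * ‖w‖ₑ := by
        refine lintegral_mono fun x => ?_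
        rw [enorm_mul, mul_comm, mul_assoc, Real.enorm_of_nonneg (φ.nonneg_normed _)]
        gcongr
        rw [← ofReal_norm, ← ofReal_norm, ← ofReal_norm, ← ENNReal.ofReal_mul (norm_nonneg _)]
        exact ENNReal.ofReal_le_ofReal (norm_inner_le_norm _ _)
    _ = (∫⁻ x in Ω, ENNReal.ofReal (φ.normed volume (y - x)) * ‖G x‖ₑ) * ‖w‖ₑ :=
        lintegral_mul_const' _ _ enorm_ne_top
    _ = _ := by
        congr 1
        rw [← lintegral_indicator hΩ, ← lintegral_add_left_eq_self _ y]
        refine lintegral_congr fun t => ?_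
        by_cases hx : y + t ∈ Ω
        · simp [hx, φ.normed_neg]
        · simp [hx]

end Mollify

/-! ### The oscillation estimate for weakly differentiable functions -/

section Oscillation
variable {N : ℕ}

theorem measurable_lintegral_ball {c : Euc N → Euc N} (hc : Measurable c) (ρ : ℝ)
    {f : Euc N × Euc N → ℝ≥0∞} (hf : Measurable f) :
    Measurable fun x => ∫⁻ z in Metric.ball (c x) ρ, f (x, z) := by
  have hm : MeasurableSet {q : Euc N × Euc N | dist q.2 (c q.1) < ρ} :=
    measurableSet_lt (measurable_snd.dist (hc.comp measurable_fst)) measurable_const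
  have h := (hf.indicator hm).lintegral_prod_right' (ν := volume)
  convert h using 2 with x
  rw [← lintegral_indicator measurableSet_ball]
  rfl

theorem isClosed_setOf_ball_subset (Ω : Set (Euc N)) (d : ℝ) :
    IsClosed {x | Metric.ball x d ⊆ Ω} := by
  have : {x | Metric.ball x d ⊆ Ω} = (Metric.thickening d Ωᶜ)ᶜ := by
    ext x
    simp only [mem_ofPred_eq, mem_compl_iff, Metric.mem_thickening_iff, not_exists, not_and]
    constructor
    · intro h z hz hd
      exact hz (h (by rwa [Metric.mem_ball, dist_comm]))
    · intro h z hz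
      by_contra hzΩ
      exact h z hzΩ (by rwa [dist_comm])
  rw [this]
  exact Metric.isOpen_thickening.isClosed_compl

/-- The oscillation estimate. To each `x ∈ S` a ball `B(c(x), ρ)` is attached, such that translations along
the segments from `x` into this ball map small balls `B(x, d) ⊆ Ω` into `Ω`. Then the `L^r` norm of
the oscillation of `u` over the attached balls is at most the `L^s` norm of the truncated Riesz kernel
times the `L^p` norm of the weak gradient. The bound passes from the mollifications of `u` to `u` by
Fatou's lemma, applied once in `z` and once in `x`. -/
theorem lintegral_oscillation_rpow_le (hN : 2 ≤ N) {Ω : Set (Euc N)} (hΩ : IsOpen Ω)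
    {u : Euc N → ℝ} {G : Euc N → Euc N} (hGm : Measurable G)
    (hu : IntegrableOn u Ω) (h : HasWeakGradient Ω u G) {S : Set (Euc N)}
    (hS : MeasurableSet S) (hSΩ : S ⊆ Ω) {c : Euc N → Euc N} (hc : Measurable c) {ρ L d₀ : ℝ}
    (hL : 0 < L) (hd₀ : 0 < d₀) (hball : ∀ x ∈ S, Metric.ball (c x) ρ ⊆ Metric.ball x L)
    (hhull : ∀ x ∈ S, ∀ z ∈ Metric.ball (c x) ρ, ∀ t ∈ Icc (0 : ℝ) 1, ∀ d ∈ Ioc 0 d₀,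
      Metric.ball x d ⊆ Ω → Metric.ball (x + t • (z - x)) d ⊆ Ω)
    {p r s : ℝ} (hp : 1 ≤ p) (hs : 1 ≤ s) (hr : 0 < r) (hprs : 1 / p + 1 / s = 1 + 1 / r) :
    ∫⁻ x in S, (∫⁻ z in Metric.ball (c x) ρ, ‖u x - u z‖ₑ) ^ r ≤
      (∫⁻ y, truncRiesz N L y ^ s) ^ (r / s) * (∫⁻ x in Ω, ‖G x‖ₑ ^ p) ^ (r / p) := by
  set ub : Euc N → ℝ := Ω.indicator u
  set g : Euc N → ℝ≥0∞ := Ω.indicator fun x => ‖G x‖ₑ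
  have hubi : Integrable ub := hu.integrable_indicator hΩ.measurableSet
  have hgm : Measurable g := hGm.enorm.indicator hΩ.measurableSet
  have hp0 : 0 < p := by linarith
  have hδ : ∀ n : ℕ, 0 < d₀ / (2 * ((n : ℝ) + 1)) := fun n => by positivity
  let φ : ℕ → ContDiffBump (0 : Euc N) := fun n =>
    ⟨d₀ / (2 * ((n : ℝ) + 1)) / 2, d₀ / (2 * ((n : ℝ) + 1)), half_pos (hδ n), half_lt_self (hδ n)⟩
  have hφ0 : Tendsto (fun n => (φ n).rOut) atTop (𝓝 0) := by
    have h1 : Tendsto (fun n : ℕ => d₀ / 2 * (1 / ((n : ℝ) + 1))) atTop (𝓝 (d₀ / 2 * 0)) :=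
      tendsto_one_div_add_atTop_nhds_zero_nat.const_mul _
    rw [mul_zero] at h1
    refine h1.congr fun n => ?_
    change d₀ / 2 * (1 / ((n : ℝ) + 1)) = d₀ / (2 * ((n : ℝ) + 1))
    field_simp
  have hφd : ∀ n, 2 * (φ n).rOut ≤ d₀ := fun n => by
    change 2 * (d₀ / (2 * ((n : ℝ) + 1))) ≤ d₀
    have : 2 * (d₀ / (2 * ((n : ℝ) + 1))) = d₀ / ((n : ℝ) + 1) := by field_simp
    rw [this]
    exact div_le_self hd₀.le (by linarith [(Nat.cast_nonneg n : (0 : ℝ) ≤ n)])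
  let v : ℕ → Euc N → ℝ := fun n => mollify (φ n) ub
  have hv : ∀ n, ContDiff ℝ 1 (v n) := fun n => contDiff_mollify _ hubi
  have hae : ∀ᵐ x, Tendsto (fun n => v n x) atTop (𝓝 (ub x)) :=
    ContDiffBump.ae_convolution_tendsto_right_of_locallyIntegrable (K := 2) hφ0
      (Eventually.of_forall fun n => by
        change d₀ / (2 * ((n : ℝ) + 1)) ≤ 2 * (d₀ / (2 * ((n : ℝ) + 1)) / 2)
        linarith) hubi.locallyIntegrable
  -- Points of `S` at distance at least twice the mollification radius from the complement of `Ω`.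
  let S' : ℕ → Set (Euc N) := fun n => S ∩ {x | Metric.ball x (2 * (φ n).rOut) ⊆ Ω}
  have hS' : ∀ n, MeasurableSet (S' n) := fun n =>
    hS.inter (isClosed_setOf_ball_subset _ _).measurableSet
  let a : ℕ → Euc N → ℝ≥0∞ := fun n x => ∫⁻ z in Metric.ball (c x) ρ, ‖v n x - v n z‖ₑ
  have ham : ∀ n, Measurable (a n) := fun n =>
    measurable_lintegral_ball hc ρ (f := fun q => ‖v n q.1 - v n q.2‖ₑ)
      (((hv n).continuous.measurable.comp measurable_fst).sub
        ((hv n).continuous.measurable.comp measurable_snd)).enorm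
  let F : ℕ → Euc N → ℝ≥0∞ := fun n => (S' n).indicator fun x => a n x ^ r
  have hFm : ∀ n, Measurable (F n) := fun n => ((ham n).pow_const r).indicator (hS' n)
  let gn : ℕ → Euc N → ℝ≥0∞ := fun n y =>
    ∫⁻ t, ENNReal.ofReal ((φ n).normed volume t) * g (y + t)
  have hρm : ∀ n, Measurable fun t => ENNReal.ofReal ((φ n).normed volume t) := fun n =>
    (φ n).continuous_normed.measurable.ennreal_ofReal
  have hgnm : ∀ n, Measurable (gn n) := fun n => by
    have : Measurable fun q : Euc N × Euc N =>
        ENNReal.ofReal ((φ n).normed volume q.2) * g (q.1 + q.2) :=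
      ((hρm n).comp measurable_snd).mul (hgm.comp (measurable_fst.add measurable_snd))
    exact this.lintegral_prod_right'
  have hgnp : ∀ n, ∫⁻ y, gn n y ^ p ≤ ∫⁻ x in Ω, ‖G x‖ₑ ^ p := fun n => by
    have h1 := lintegral_convolution_rpow_le (hρm n) hgm hp le_rfl hp0
      (show 1 / p + 1 / 1 = 1 + 1 / p by ring)
    have h2 : ∫⁻ t, ENNReal.ofReal ((φ n).normed volume t) = 1 := by
      rw [← ofReal_integral_eq_lintegral_ofReal (φ n).integrable_normed
        (Eventually.of_forall (φ n).nonneg_normed), (φ n).integral_normed, ENNReal.ofReal_one]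
    simp only [ENNReal.rpow_one, h2, ENNReal.one_rpow, one_mul, div_self hp0.ne'] at h1
    refine h1.trans (le_of_eq ?_)
    rw [← lintegral_indicator hΩ.measurableSet]
    refine lintegral_congr fun x => ?_
    by_cases hx : x ∈ Ω <;> simp [g, hx, hp0]
  have hbound : ∀ n, ∫⁻ x, F n x ≤
      (∫⁻ y, truncRiesz N L y ^ s) ^ (r / s) * (∫⁻ x in Ω, ‖G x‖ₑ ^ p) ^ (r / p) := by
    intro n
    calc ∫⁻ x, F n x ≤ ∫⁻ x, (∫⁻ y, truncRiesz N L y * gn n (x + y)) ^ r := by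
          refine lintegral_mono fun x => ?_
          by_cases hx : x ∈ S' n
          · simp only [F, indicator_of_mem hx]
            refine ENNReal.rpow_le_rpow ?_ hr.le
            refine lintegral_enorm_sub_le_truncRiesz hN hL (hv n) (hgnm n) measurableSet_ball
              (hball x hx.1) fun z hz t ht => ?_
            refine enorm_fderiv_mollify_le (φ n) hΩ.measurableSet h hu ?_
            refine (Metric.closedBall_subset_ball ?_).trans
              (hhull x hx.1 z hz t ht (2 * (φ n).rOut) ⟨?_, hφd n⟩ hx.2)
            · linarith [(φ n).rOut_pos]
            · linarith [(φ n).rOut_pos]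
          · simp only [F, indicator_of_notMem hx]
            exact zero_le
      _ ≤ (∫⁻ y, truncRiesz N L y ^ s) ^ (r / s) * (∫⁻ y, gn n y ^ p) ^ (r / p) :=
          lintegral_convolution_rpow_le (measurable_truncRiesz L) (hgnm n) hp hs hr hprs
      _ ≤ _ := by
          exact mul_le_mul_right (ENNReal.rpow_le_rpow (hgnp n) (by positivity)) _
  calc ∫⁻ x in S, (∫⁻ z in Metric.ball (c x) ρ, ‖u x - u z‖ₑ) ^ r
      ≤ ∫⁻ x, liminf (fun n => F n x) atTop := by
        rw [← lintegral_indicator hS]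
        refine lintegral_mono_ae ?_
        filter_upwards [hae] with x hx
        by_cases hxS : x ∈ S
        · rw [indicator_of_mem hxS]
          obtain ⟨ε, hε, hεΩ⟩ := Metric.isOpen_iff.1 hΩ x (hSΩ hxS)
          have hev : ∀ᶠ n in atTop, F n x = a n x ^ r := by
            have h2 : Tendsto (fun n => 2 * (φ n).rOut) atTop (𝓝 (2 * 0)) := hφ0.const_mul 2
            rw [mul_zero] at h2
            filter_upwards [h2.eventually_le_const hε] with n hn
            have hxn : x ∈ S' n := ⟨hxS, (Metric.ball_subset_ball hn).trans hεΩ⟩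
            exact indicator_of_mem hxn _
          rw [liminf_congr hev]
          have hBΩ : Metric.ball (c x) ρ ⊆ Ω := fun z hz => by
            have h3 := hhull x hxS z hz 1 ⟨zero_le_one, le_rfl⟩ (min ε d₀)
              ⟨lt_min hε hd₀, min_le_right _ _⟩
              ((Metric.ball_subset_ball (min_le_left _ _)).trans hεΩ)
            rw [one_smul, add_sub_cancel] at h3
            exact h3 (Metric.mem_ball_self (lt_min hε hd₀))
          have h4 : ∫⁻ z in Metric.ball (c x) ρ, ‖u x - u z‖ₑ ≤ liminf (fun n => a n x) atTop := by
            refine le_trans (lintegral_mono_ae ?_) (lintegral_liminf_le fun n =>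
              ((hv n).continuous.measurable.const_sub (v n x)).enorm)
            filter_upwards [ae_restrict_of_ae hae, ae_restrict_mem measurableSet_ball] with z hz hzB
            have h5 : Tendsto (fun n => ‖v n x - v n z‖ₑ) atTop (𝓝 ‖ub x - ub z‖ₑ) :=
              (hx.sub hz).enorm
            rw [h5.liminf_eq]
            simp only [ub, indicator_of_mem (hSΩ hxS), indicator_of_mem (hBΩ hzB), le_refl]
          refine (ENNReal.rpow_le_rpow h4 hr.le).trans (le_of_eq ?_)
          exact (ENNReal.orderIsoRpow r hr).liminf_apply
        · rw [indicator_of_notMem hxS]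
          exact zero_le
    _ ≤ liminf (fun n => ∫⁻ x, F n x) atTop := lintegral_liminf_le hFm
    _ ≤ _ := (liminf_le_liminf (Eventually.of_forall hbound)).trans (liminf_const _).le

end Oscillation

/-! ### The space `L^H`: embedding into `L¹`, completeness, multiplication by indicators -/

namespace Data
section Space
set_option linter.unusedSectionVars false
variable {N : ℕ} (D : Data N) {F : Type*} [NormedAddCommGroup F] [NormedSpace ℝ F]

theorem toM_add (u v : D.LH F) : (u + v).toM = u.toM + v.toM := rfl
theorem toM_sub (u v : D.LH F) : (u - v).toM = u.toM - v.toM := rfl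
theorem toM_smul (c : ℝ) (u : D.LH F) : (c • u).toM = c • u.toM := rfl
theorem toM_zero : (0 : D.LH F).toM = 0 := rfl

variable {D} in
theorem LH.ext_toM {u v : D.LH F} (h : u.toM = v.toM) : u = v := Subtype.ext h

theorem H_mono {x : Euc N} (hp : 1 < D.p x) (hq : 1 < D.q x) (hμ : 0 ≤ D.μ x) {s t : ℝ}
    (hs : 0 ≤ s) (hst : s ≤ t) : D.H x s ≤ D.H x t := by
  have h1 := Real.rpow_le_rpow hs hst (z := D.p x) (by linarith)
  have h2 := Real.rpow_le_rpow hs hst (z := D.q x) (by linarith)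
  have h3 := mul_le_mul_of_nonneg_left h2 hμ
  unfold H
  linarith

theorem modular_mono {F' : Type*} [NormedAddCommGroup F'] {u : D.M F} {v : D.M F'}
    (h : ∀ᵐ x ∂volume.restrict D.Ω, ‖u x‖ ≤ ‖v x‖) : D.modular u ≤ D.modular v := by
  refine lintegral_mono_ae ?_
  filter_upwards [h, D.ae_good] with x hx hg
  exact ENNReal.ofReal_le_ofReal (D.H_mono hg.1 hg.2.1 hg.2.2 (norm_nonneg _) hx)

/-- The Luxemburg norm is monotone with respect to pointwise domination. -/
theorem norm_mono (u v : D.LH F) (h : ∀ᵐ x ∂volume.restrict D.Ω, ‖u.toM x‖ ≤ ‖v.toM x‖) :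
    ‖u‖ ≤ ‖v‖ := by
  refine le_csInf (D.lux_nonempty v) fun τ hτ => D.lh_norm_le u hτ.1 (le_trans ?_ hτ.2)
  refine D.modular_mono ?_
  filter_upwards [h, AEEqFun.coeFn_smul τ⁻¹ u.toM, AEEqFun.coeFn_smul τ⁻¹ v.toM] with x hx h1 h2
  rw [h1, h2, Pi.smul_apply, Pi.smul_apply, norm_smul, norm_smul]
  gcongr

theorem modular_inv_smul_le_one (u : D.LH F) {τ : ℝ} (h : ‖u‖ < τ) :
    D.modular (τ⁻¹ • u.toM) ≤ 1 := by
  obtain ⟨σ, ⟨hσ, hu⟩, hστ⟩ := exists_lt_of_csInf_lt (D.lux_nonempty u) h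
  have hτ : 0 < τ := hσ.trans hστ
  refine le_trans (D.modular_mono ?_) hu
  filter_upwards [AEEqFun.coeFn_smul τ⁻¹ u.toM, AEEqFun.coeFn_smul σ⁻¹ u.toM] with x h1 h2
  rw [h1, h2, Pi.smul_apply, Pi.smul_apply, norm_smul, norm_smul, Real.norm_of_nonneg (by positivity),
    Real.norm_of_nonneg (by positivity)]
  gcongr

theorem modular_le_one (u : D.LH F) (h : ‖u‖ < 1) : D.modular u.toM ≤ 1 := by
  simpa using D.modular_inv_smul_le_one u h

theorem le_one_add_H {x : Euc N} (hμ : 0 ≤ D.μ x) {t : ℝ} (ht : 0 ≤ t) {r : ℝ}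
    (hr : 0 ≤ r) (hrp : r ≤ D.p x) : t ^ r ≤ 1 + D.H x t := by
  have h0 : 0 ≤ D.μ x * t ^ D.q x := by positivity
  have h1 : 0 ≤ t ^ D.p x := by positivity
  unfold H
  rcases le_total t 1 with h | h
  · have := Real.rpow_le_one ht h hr
    linarith
  · have := Real.rpow_le_rpow_of_exponent_le h hrp
    linarith

theorem lintegral_enorm_le (u : D.M F) :
    ∫⁻ x in D.Ω, ‖u x‖ₑ ≤ volume D.Ω + D.modular u := by
  calc ∫⁻ x in D.Ω, ‖u x‖ₑ ≤ ∫⁻ x in D.Ω, (1 + ENNReal.ofReal (D.H x ‖u x‖)) := by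
        refine lintegral_mono_ae ?_
        filter_upwards [D.ae_good] with x hx
        have h1 := D.le_one_add_H hx.2.2 (norm_nonneg (u x)) zero_le_one hx.1.le
        rw [Real.rpow_one] at h1
        rw [← ofReal_norm, ← ENNReal.ofReal_one, ← ENNReal.ofReal_add zero_le_one
          (D.H_nonneg hx.2.2 (norm_nonneg _))]
        exact ENNReal.ofReal_le_ofReal h1
    _ = _ := by
        rw [lintegral_add_left measurable_const, lintegral_const, one_mul, modular,
          Measure.restrict_apply_univ]

theorem lintegral_enorm_le_of_modular_le_one (u : D.M F) {τ : ℝ} (hτ : 0 < τ)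
    (h : D.modular (τ⁻¹ • u) ≤ 1) :
    ∫⁻ x in D.Ω, ‖u x‖ₑ ≤ ENNReal.ofReal τ * (volume D.Ω + 1) := by
  have h1 := (D.lintegral_enorm_le (τ⁻¹ • u)).trans (add_le_add le_rfl h)
  have h2 : ∫⁻ x in D.Ω, ‖u x‖ₑ = ENNReal.ofReal τ * ∫⁻ x in D.Ω, ‖(τ⁻¹ • u) x‖ₑ := by
    rw [← lintegral_const_mul' _ _ ENNReal.ofReal_ne_top]
    refine lintegral_congr_ae ?_
    filter_upwards [AEEqFun.coeFn_smul τ⁻¹ u] with x hx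
    rw [hx, Pi.smul_apply, enorm_smul, ← mul_assoc, Real.enorm_of_nonneg (by positivity),
      ← ENNReal.ofReal_mul hτ.le, mul_inv_cancel₀ hτ.ne', ENNReal.ofReal_one, one_mul]
  rw [h2]
  gcongr

theorem integrable_toM (hV : volume D.Ω ≠ ⊤) (u : D.LH F) : IntegrableOn u.toM D.Ω := by
  refine ⟨u.toM.aestronglyMeasurable, ?_⟩
  obtain ⟨τ, hτ, h⟩ := D.lux_nonempty u
  refine (D.lintegral_enorm_le_of_modular_le_one u.toM hτ h).trans_lt ?_
  exact ENNReal.mul_lt_top ENNReal.ofReal_lt_top (by simp [hV.lt_top])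

theorem integral_norm_toM_le (hV : volume D.Ω ≠ ⊤) (u : D.LH F) :
    ∫ x in D.Ω, ‖u.toM x‖ ≤ (volume.real D.Ω + 1) * ‖u‖ := by
  have hpos : 0 < volume.real D.Ω + 1 := by positivity
  rw [← div_le_iff₀' hpos]
  refine le_csInf (D.lux_nonempty u) fun τ hτ => ?_
  rw [div_le_iff₀' hpos, integral_norm_eq_lintegral_enorm u.toM.aestronglyMeasurable]
  refine ENNReal.toReal_le_of_le_ofReal (by have := hτ.1; positivity) ?_
  refine (D.lintegral_enorm_le_of_modular_le_one u.toM hτ.1 hτ.2).trans (le_of_eq ?_)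
  rw [mul_comm, ENNReal.ofReal_mul hpos.le, ENNReal.ofReal_add measureReal_nonneg zero_le_one,
    ofReal_measureReal hV, ENNReal.ofReal_one]

/-- The embedding of `L^H` into `L¹` on a set of finite measure. -/
def toL1 (hV : volume D.Ω ≠ ⊤) : D.LH F →L[ℝ] Lp F 1 (volume.restrict D.Ω) :=
  LinearMap.mkContinuous
    { toFun := fun u => ⟨u.toM, by
        have h := memLp_one_iff_integrable.2 (D.integrable_toM hV u)
        exact Lp.mem_Lp_iff_memLp.2 h⟩
      map_add' := fun _ _ => rfl
      map_smul' := fun _ _ => rfl }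
    (volume.real D.Ω + 1) fun u => by
      refine le_trans (le_of_eq ?_) (D.integral_norm_toM_le hV u)
      rw [L1.norm_eq_integral_norm]
      rfl

/-- Lower semicontinuity of the modular under almost everywhere convergence. -/
theorem modular_le_of_tendsto {w : ℕ → D.M F} {w₀ : D.M F} {C : ℝ≥0∞}
    (h : ∀ᵐ x ∂volume.restrict D.Ω, Tendsto (fun n => w n x) atTop (𝓝 (w₀ x)))
    (hw : ∀ᶠ n in atTop, D.modular (w n) ≤ C) : D.modular w₀ ≤ C := by
  calc D.modular w₀ ≤ ∫⁻ x in D.Ω, liminf (fun n => ENNReal.ofReal (D.H x ‖w n x‖)) atTop := by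
        refine lintegral_mono_ae ?_
        filter_upwards [h, D.ae_good] with x hx hg
        have h1 : Tendsto (fun n => ENNReal.ofReal (D.H x ‖w n x‖)) atTop
            (𝓝 (ENNReal.ofReal (D.H x ‖w₀ x‖))) := by
          refine ENNReal.tendsto_ofReal ?_
          exact (hx.norm.rpow_const (Or.inr (by linarith [hg.1]))).add
            ((hx.norm.rpow_const (Or.inr (by linarith [hg.2.1]))).const_mul _)
        rw [h1.liminf_eq]
    _ ≤ liminf (fun n => D.modular (w n)) atTop := lintegral_liminf_le' fun n => D.aemeasurable_H _
    _ ≤ C := (liminf_le_liminf hw).trans (liminf_const _).le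

/-- A Cauchy sequence in `L^H` converges in `L¹`, hence almost everywhere along a subsequence; lower
semicontinuity of the modular turns this into convergence in `L^H`. -/
theorem completeSpace_LH (hV : volume D.Ω ≠ ⊤) [CompleteSpace F] : CompleteSpace (D.LH F) := by
  refine Metric.complete_of_cauchySeq_tendsto fun u hu => ?_
  obtain ⟨f, hf⟩ := cauchySeq_tendsto_of_complete
    ((D.toL1 hV).uniformContinuous.comp_cauchySeq hu)
  obtain ⟨k, hk, hkf⟩ := (tendstoInMeasure_of_tendsto_Lp hf).exists_seq_tendsto_ae
  have key : ∀ τ : ℝ, 0 < τ → ∃ n₀, ∀ n ≥ n₀, D.modular (τ⁻¹ • ((u n).toM - f.1)) ≤ 1 := by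
    intro τ hτ
    obtain ⟨n₀, hn₀⟩ := Metric.cauchySeq_iff.1 hu τ hτ
    refine ⟨n₀, fun n hn => D.modular_le_of_tendsto (w := fun j => τ⁻¹ • (u n - u (k j)).toM) ?_ ?_⟩
    · have h1 : ∀ᵐ x ∂volume.restrict D.Ω, ∀ j, (τ⁻¹ • (u n - u (k j)).toM : D.M F) x =
          τ⁻¹ • ((u n).toM x - (u (k j)).toM x) := by
        rw [ae_all_iff]
        intro j
        filter_upwards [AEEqFun.coeFn_smul τ⁻¹ (u n - u (k j)).toM,
          AEEqFun.coeFn_sub (u n).toM (u (k j)).toM] with x h1 h2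
        rw [h1, Pi.smul_apply, toM_sub, h2, Pi.sub_apply]
      filter_upwards [h1, hkf, AEEqFun.coeFn_smul τ⁻¹ ((u n).toM - f.1),
          AEEqFun.coeFn_sub (u n).toM f.1] with x h2 h3 h4 h5
      simp_rw [h2]
      rw [h4, Pi.smul_apply, h5, Pi.sub_apply]
      exact (tendsto_const_nhds.sub h3).const_smul _
    · filter_upwards [hk.tendsto_atTop.eventually_ge_atTop n₀] with j hj
      refine D.modular_inv_smul_le_one _ ?_
      rw [← dist_eq_norm]
      exact hn₀ n hn _ hj
  -- The limit lies in `L^H` because it differs from some `u n₁` by an element of `L^H`.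
  obtain ⟨n₁, hn₁⟩ := key 1 one_pos
  have hmem : (u n₁).toM - f.1 ∈ D.lhSubmodule F :=
    ⟨1⁻¹, by norm_num, (hn₁ n₁ le_rfl).trans_lt ENNReal.one_lt_top⟩
  let e : D.LH F := (⟨(u n₁).toM - f.1, hmem⟩ : D.lhSubmodule F)
  let w : D.LH F := u n₁ - e
  have hw : w.toM = f.1 := by
    change (u n₁).toM - ((u n₁).toM - f.1) = f.1
    exact sub_sub_cancel _ _
  refine ⟨w, Metric.tendsto_atTop.2 fun ε hε => ?_⟩
  obtain ⟨n₀, hn₀⟩ := key (ε / 2) (half_pos hε)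
  refine ⟨n₀, fun n hn => ?_⟩
  rw [dist_eq_norm]
  refine (D.lh_norm_le _ (half_pos hε) ?_).trans_lt (half_lt_self hε)
  rw [toM_sub, hw]
  exact hn₀ n hn

/-- Multiplication by the indicator function of `A`, as an operator on `L^H`. -/
def restr {A : Set (Euc N)} (hA : MeasurableSet A) : D.LH F →L[ℝ] D.LH F :=
  let T : D.M F → D.M F := fun u =>
    AEEqFun.mk (A.indicator u) (u.aestronglyMeasurable.indicator hA)
  have hT : ∀ u, T u =ᵐ[volume.restrict D.Ω] A.indicator u := fun u => AEEqFun.coeFn_mk _ _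
  have hle : ∀ u : D.M F, ∀ᵐ x ∂volume.restrict D.Ω, ‖T u x‖ ≤ ‖u x‖ := fun u => by
    filter_upwards [hT u] with x hx
    rw [hx]
    exact norm_indicator_le_norm_self _ _
  have hsmul : ∀ (c : ℝ) (u : D.M F), T (c • u) = c • T u := fun c u => by
    refine AEEqFun.ext ?_
    filter_upwards [hT (c • u), AEEqFun.coeFn_smul c (T u), hT u, AEEqFun.coeFn_smul c u]
      with x h1 h2 h3 h4
    rw [h1, h2, Pi.smul_apply, h3]
    by_cases hx : x ∈ A <;> simp [hx, h4]
  LinearMap.mkContinuous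
    { toFun := fun u => (⟨T u.toM, by
        obtain ⟨α, hα, h⟩ := u.2
        refine ⟨α, hα, lt_of_le_of_lt ?_ h⟩
        rw [← hsmul]
        exact D.modular_mono (hle _)⟩ : D.lhSubmodule F)
      map_add' := fun u v => by
        refine Subtype.ext (AEEqFun.ext ?_)
        change T (u.toM + v.toM) =ᵐ[volume.restrict D.Ω] (T u.toM + T v.toM : D.M F)
        filter_upwards [hT (u.toM + v.toM), AEEqFun.coeFn_add (T u.toM) (T v.toM), hT u.toM,
          hT v.toM, AEEqFun.coeFn_add u.toM v.toM] with x h1 h2 h3 h4 h5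
        rw [h1, h2, Pi.add_apply, h3, h4]
        by_cases hx : x ∈ A <;> simp [hx, h5]
      map_smul' := fun c u => Subtype.ext (hsmul c u.toM) }
    1 fun u => by
      rw [one_mul]
      exact D.norm_mono _ _ (hle u.toM)

theorem restr_coe {A : Set (Euc N)} (hA : MeasurableSet A) (u : D.LH F) :
    (D.restr hA u).toM =ᵐ[volume.restrict D.Ω] A.indicator u.toM := AEEqFun.coeFn_mk _ _

theorem norm_restr_le {A : Set (Euc N)} (hA : MeasurableSet A) (u : D.LH F) :
    ‖D.restr hA u‖ ≤ ‖u‖ := by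
  refine D.norm_mono _ _ ?_
  filter_upwards [D.restr_coe hA u] with x hx
  rw [hx]
  exact norm_indicator_le_norm_self _ _

theorem restr_union {A B : Set (Euc N)} (hA : MeasurableSet A) (hB : MeasurableSet B)
    (u : D.LH F) :
    D.restr (hA.union hB) u = D.restr hA u + D.restr hA.compl (D.restr hB u) := by
  refine LH.ext_toM (AEEqFun.ext ?_)
  rw [toM_add]
  filter_upwards [D.restr_coe (hA.union hB) u, D.restr_coe hA u, D.restr_coe hB u,
    D.restr_coe hA.compl (D.restr hB u), AEEqFun.coeFn_add (D.restr hA u).toM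
      (D.restr hA.compl (D.restr hB u)).toM] with x h1 h2 h3 h4 h5
  rw [h5, Pi.add_apply, h1, h2, h4]
  by_cases hxA : x ∈ A <;> by_cases hxB : x ∈ B <;> simp [hxA, hxB, h3]

/-- For bounded `μ` and `Ω` of finite measure, `L^H` contains the constant function one. -/
theorem exists_one (hV : volume D.Ω ≠ ⊤) {m : ℝ} (hm : ∀ᵐ x ∂volume.restrict D.Ω, D.μ x ≤ m) :
    ∃ b : D.LH ℝ, b.toM =ᵐ[volume.restrict D.Ω] fun _ => 1 := by
  refine ⟨(⟨AEEqFun.const _ 1, 1, one_pos, ?_⟩ : D.lhSubmodule ℝ), AEEqFun.coeFn_const _ _⟩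
  rw [one_smul]
  calc D.modular (AEEqFun.const (Euc N) (1 : ℝ)) ≤ ∫⁻ x in D.Ω, ENNReal.ofReal (1 + m) := by
        refine lintegral_mono_ae ?_
        filter_upwards [AEEqFun.coeFn_const (μ := volume.restrict D.Ω) (Euc N) (1 : ℝ), hm] with x h1 h2
        rw [h1]
        refine ENNReal.ofReal_le_ofReal ?_
        simp [H, h2]
    _ < ⊤ := by
        rw [lintegral_const, Measure.restrict_apply_univ]
        exact ENNReal.mul_lt_top ENNReal.ofReal_lt_top hV.lt_top

end Space
end Data

/-! ### Averaging operators of finite rank, and the uniform cone property -/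

theorem isCompactOperator_smulRight {X Y : Type*} [NormedAddCommGroup X] [NormedSpace ℝ X]
    [NormedAddCommGroup Y] [NormedSpace ℝ Y] (f : X →L[ℝ] ℝ) (b : Y) :
    IsCompactOperator (f.smulRight b) := by
  exact (isCompactOperator_of_locallyCompactSpace_dom f).clm_comp
    ((ContinuousLinearMap.id ℝ ℝ).smulRight b)

namespace Data
section FiniteRank
variable {N : ℕ} (D : Data N)

/-- The functional `f ↦ |B|⁻¹ ∫_{B ∩ Ω} f` on `L¹(Ω)`, for `B` the ball of radius `ρ` about `x`. It is the
average over `B` when `B ⊆ Ω`. -/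
def avg (x : Euc N) (ρ : ℝ) : Lp ℝ 1 (volume.restrict D.Ω) →L[ℝ] ℝ :=
  LinearMap.mkContinuous
    { toFun := fun f => (volume.real (Metric.ball x ρ))⁻¹ *
        ∫ z in Metric.ball x ρ, f z ∂volume.restrict D.Ω
      map_add' := fun f g => by
        rw [integral_congr_ae (ae_restrict_of_ae (Lp.coeFn_add f g))]
        simp only [Pi.add_apply]
        rw [integral_add (L1.integrable_coeFn f).integrableOn (L1.integrable_coeFn g).integrableOn,
          mul_add]
      map_smul' := fun a f => by
        rw [integral_congr_ae (ae_restrict_of_ae (Lp.coeFn_smul a f))]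
        simp only [Pi.smul_apply, smul_eq_mul, RingHom.id_apply]
        rw [integral_const_mul]
        ring }
    (volume.real (Metric.ball x ρ))⁻¹ fun f => by
      simp only [LinearMap.coe_mk, AddHom.coe_mk, norm_mul, norm_inv, Real.norm_of_nonneg
        measureReal_nonneg]
      gcongr
      rw [L1.norm_eq_integral_norm]
      exact (norm_integral_le_integral_norm _).trans
        (setIntegral_le_integral (L1.integrable_coeFn f).norm
          (Eventually.of_forall fun _ => norm_nonneg _))

theorem avg_apply (x : Euc N) (ρ : ℝ) (f : Lp ℝ 1 (volume.restrict D.Ω)) :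
    D.avg x ρ f = (volume.real (Metric.ball x ρ))⁻¹ * ∫ z in Metric.ball x ρ ∩ D.Ω, f z := by
  rw [← Measure.restrict_restrict measurableSet_ball]
  rfl

theorem toM_sum {ι : Type*} (s : Finset ι) (f : ι → D.LH ℝ) :
    (∑ i ∈ s, f i).toM =ᵐ[volume.restrict D.Ω] fun x => ∑ i ∈ s, (f i).toM x := by
  classical
  induction s using Finset.induction with
  | empty => exact AEEqFun.coeFn_zero
  | insert i s hi ih =>
    rw [Finset.sum_insert hi, toM_add]
    filter_upwards [ih, AEEqFun.coeFn_add (f i).toM (∑ i ∈ s, f i).toM] with x h1 h2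
    rw [h2, Pi.add_apply, h1, Finset.sum_insert hi]

/-- The operator that replaces `f` at `x ∈ A` by its average over the ball attached to `x`. It has finite
rank since the centres `c` take finitely many values, and it is defined on `L¹(Ω)`. -/
theorem exists_finiteRank (hV : volume D.Ω ≠ ⊤) {m : ℝ}
    (hm : ∀ᵐ x ∂volume.restrict D.Ω, D.μ x ≤ m) {A : Set (Euc N)} (hA : MeasurableSet A)
    (c : SimpleFunc (Euc N) (Euc N)) (ρ : ℝ) :
    ∃ T : Lp ℝ 1 (volume.restrict D.Ω) →L[ℝ] D.LH ℝ, IsCompactOperator T ∧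
      ∀ f, (T f).toM =ᵐ[volume.restrict D.Ω] A.indicator fun x => D.avg (c x) ρ f := by
  obtain ⟨b, hb⟩ := D.exists_one hV hm
  let P : Euc N → Set (Euc N) := fun a => A ∩ c ⁻¹' {a}
  have hP : ∀ a, MeasurableSet (P a) := fun a => hA.inter (c.measurableSet_preimage _)
  let T : Lp ℝ 1 (volume.restrict D.Ω) →L[ℝ] D.LH ℝ :=
    ∑ a ∈ c.range, (D.avg a ρ).smulRight (D.restr (hP a) b)
  refine ⟨T, ?_, fun f => ?_⟩
  · exact Submodule.sum_mem (compactOperator (RingHom.id ℝ) _ (D.LH ℝ)) fun a _ =>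
      isCompactOperator_smulRight _ _
  · have h1 : T f = ∑ a ∈ c.range, D.avg a ρ f • D.restr (hP a) b := by
      simp [T]
    rw [h1]
    have h2 : ∀ᵐ x ∂volume.restrict D.Ω, ∀ a ∈ c.range,
        (D.avg a ρ f • D.restr (hP a) b : D.LH ℝ).toM x = (P a).indicator (fun _ => D.avg a ρ f) x := by
      rw [Filter.eventually_all_finset]
      intro a _
      rw [toM_smul]
      filter_upwards [AEEqFun.coeFn_smul (D.avg a ρ f) (D.restr (hP a) b).toM,
        D.restr_coe (hP a) b, hb] with x h3 h4 h5
      rw [h3, Pi.smul_apply, h4]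
      by_cases hx : x ∈ P a <;> simp [hx, h5]
    filter_upwards [D.toM_sum c.range fun a => D.avg a ρ f • D.restr (hP a) b, h2] with x h3 h4
    rw [h3, Finset.sum_congr rfl h4]
    by_cases hx : x ∈ A
    · rw [indicator_of_mem hx, Finset.sum_eq_single (c x)]
      · have hxP : x ∈ P (c x) := ⟨hx, rfl⟩
        exact indicator_of_mem hxP _
      · intro a _ ha
        exact indicator_of_notMem (fun h => ha h.2.symm) _
      · exact fun h => absurd (c.mem_range_self x) h
    · rw [indicator_of_notMem hx]
      exact Finset.sum_eq_zero fun a _ => indicator_of_notMem (fun h => hx h.1) _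

end FiniteRank
end Data

section Cone
variable {N : ℕ}

/-- The uniform cone property of `Ω` near `x₀`: for all `x ∈ Ω` near `x₀` the vectors `t e + b` with
`0 ≤ t ≤ R` and `‖b‖ ≤ k t`, which form a truncated cone with axis `e`, lead from `x` to points of `Ω`. -/
def HasUniformCone (Ω : Set (Euc N)) (x₀ : Euc N) : Prop :=
  ∃ (e : Euc N) (k R : ℝ), ‖e‖ = 1 ∧ 0 < k ∧ k ≤ 1 ∧ 0 < R ∧
    ∀ x ∈ Ω ∩ Metric.ball x₀ R, ∀ t ∈ Icc 0 R, ∀ b : Euc N, ‖b‖ ≤ t * k → x + (t • e + b) ∈ Ω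

theorem hasUniformCone_of_mem (hN : 1 ≤ N) {Ω : Set (Euc N)} (hΩ : IsOpen Ω) {x₀ : Euc N}
    (hx₀ : x₀ ∈ Ω) : HasUniformCone Ω x₀ := by
  obtain ⟨r, hr, h⟩ := Metric.isOpen_iff.1 hΩ x₀ hx₀
  refine ⟨EuclideanSpace.single ⟨0, by omega⟩ 1, 1, r / 3, by simp, one_pos, le_rfl, by positivity,
    fun x hx t ht b hb => h ?_⟩
  have h1 := mem_ball_iff_norm.1 hx.2
  rw [mem_ball_iff_norm, add_sub_right_comm]
  refine (norm_add_le _ _).trans_lt ?_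
  have h2 : ‖t • EuclideanSpace.single (⟨0, by omega⟩ : Fin N) (1 : ℝ) + b‖ ≤ t + t * 1 := by
    refine (norm_add_le _ _).trans (add_le_add ?_ hb)
    rw [norm_smul, Real.norm_of_nonneg ht.1]
    simp
  linarith [ht.2]

/-- For a graph with Lipschitz constant `K` the opening `k = 1 / (K + 1)` works: a step `t e + b` gains at
least `t - ‖b‖` in height, while the graph rises by at most `K ‖b‖`. -/
theorem HasLipschitzBoundary.hasUniformCone {Ω : Set (Euc N)} (h : HasLipschitzBoundary Ω)
    {x₀ : Euc N} (hx₀ : x₀ ∈ frontier Ω) : HasUniformCone Ω x₀ := by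
  obtain ⟨e, γ, K, r, he, hγ, hinv, hr, hmem⟩ := h x₀ hx₀
  have hK : (0 : ℝ) < K + 1 := by positivity
  have hk1 : ((K : ℝ) + 1)⁻¹ ≤ 1 := inv_le_one_of_one_le₀ (by linarith [K.2])
  refine ⟨e, ((K : ℝ) + 1)⁻¹, r / 3, he, by positivity, hk1, by positivity,
    fun x hx t ht b hb => ?_⟩
  have hb' : ‖b‖ * (K + 1) ≤ t := by
    rwa [← div_eq_mul_inv, le_div_iff₀ hK] at hb
  have hbt : ‖b‖ ≤ t := hb.trans (by nlinarith [ht.1])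
  have h1 := mem_ball_iff_norm.1 hx.2
  have hxr : x ∈ Metric.ball x₀ r := mem_ball_iff_norm.2 (by linarith)
  have hyr : x + (t • e + b) ∈ Metric.ball x₀ r := by
    rw [mem_ball_iff_norm, add_sub_right_comm]
    refine (norm_add_le _ _).trans_lt ?_
    have h2 : ‖t • e + b‖ ≤ t + t := by
      refine (norm_add_le _ _).trans (add_le_add ?_ hbt)
      rw [norm_smul, Real.norm_of_nonneg ht.1, he, mul_one]
    linarith [ht.2]
  rw [hmem _ hyr]
  have hx' := (hmem x hxr).1 hx.1
  have h3 : γ (x + (t • e + b)) ≤ γ x + K * ‖b‖ := by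
    rw [show x + (t • e + b) = (x + b) + t • e by abel, hinv]
    have := hγ.dist_le_mul (x + b) x
    rw [Real.dist_eq, dist_eq_norm, add_sub_cancel_left] at this
    linarith [le_abs_self (γ (x + b) - γ x)]
  have h4 : inner ℝ e (x + (t • e + b)) = inner ℝ e x + t + inner ℝ e b := by
    rw [inner_add_right, inner_add_right, inner_smul_right, real_inner_self_eq_norm_sq, he]
    ring
  have h5 : -‖b‖ ≤ inner ℝ e b := by
    have := abs_real_inner_le_norm e b
    rw [he, one_mul] at this
    exact (abs_le.1 this).1
  rw [h4]
  linarith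

theorem HasLipschitzBoundary.hasUniformCone_of_mem_closure (hN : 1 ≤ N) {Ω : Set (Euc N)}
    (hΩ : IsOpen Ω) (h : HasLipschitzBoundary Ω) {x₀ : Euc N} (hx₀ : x₀ ∈ closure Ω) :
    HasUniformCone Ω x₀ := by
  by_cases hx : x₀ ∈ Ω
  · exact hasUniformCone_of_mem hN hΩ hx
  · exact h.hasUniformCone ⟨hx₀, fun h' => hx (interior_subset h')⟩

/-- A simple function moving each point of a ball by less than `δ`: the nearest point of a finite net. -/
theorem exists_simpleFunc_dist_lt (x₀ : Euc N) (R : ℝ) {δ : ℝ} (hδ : 0 < δ) :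
    ∃ f : SimpleFunc (Euc N) (Euc N), ∀ x ∈ Metric.ball x₀ R, dist (f x) x < δ := by
  have hcov : Metric.closedBall x₀ R ⊆ ⋃ n, Metric.ball (TopologicalSpace.denseSeq (Euc N) n) δ := by
    intro x _
    obtain ⟨n, hn⟩ := (TopologicalSpace.denseRange_denseSeq (Euc N)).exists_dist_lt x hδ
    exact mem_iUnion.2 ⟨n, hn⟩
  obtain ⟨s, hs⟩ := (isCompact_closedBall x₀ R).elim_finite_subcover _
    (fun _ => Metric.isOpen_ball) hcov
  refine ⟨SimpleFunc.nearestPt (TopologicalSpace.denseSeq (Euc N)) (s.sup id), fun x hx => ?_⟩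
  obtain ⟨n, hn, hxn⟩ := mem_iUnion₂.1 (hs (Metric.ball_subset_closedBall hx))
  have h1 := SimpleFunc.edist_nearestPt_le (TopologicalSpace.denseSeq (Euc N)) x
    (Finset.le_sup (f := id) hn)
  rw [edist_dist, edist_dist, ENNReal.ofReal_le_ofReal_iff dist_nonneg] at h1
  refine h1.trans_lt ?_
  rw [dist_comm]
  exact hxn

end Cone

/-! ### Subcritical exponents and smallness of the modular -/

section Exponents

/-- Room below the critical exponent: `p` can be lowered and `q` raised so that the Young exponent `s`
belonging to the new pair still makes `|y|^{(1-N)s}` locally integrable. -/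
theorem exists_subcritical_exponents {N : ℕ} {p q : ℝ} (hp : 1 < p) (hpN : p < N) (hpq : p < q)
    (hq : q < sobolevConj N p) :
    ∃ p₀ q₀ s : ℝ, 1 < p₀ ∧ p₀ < p ∧ q < q₀ ∧ 1 ≤ s ∧ ((N : ℝ) - 1) * s < N ∧
      1 / p₀ + 1 / s = 1 + 1 / q₀ := by
  have hN : (1 : ℝ) < N := hp.trans hpN
  have h0 : 1 / p - 1 / q < 1 / (N : ℝ) := by
    rw [sobolevConj, lt_div_iff₀ (by linarith)] at hq
    rw [div_sub_div _ _ (by linarith) (by linarith), div_lt_div_iff₀ (by nlinarith) (by linarith)]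
    nlinarith
  have hc : Tendsto (fun a : ℝ => 1 / (p - a) - 1 / (q + a)) (𝓝[>] 0)
      (𝓝 (1 / (p - 0) - 1 / (q + 0))) := by
    refine Tendsto.mono_left ?_ nhdsWithin_le_nhds
    have : ContinuousAt (fun a : ℝ => 1 / (p - a) - 1 / (q + a)) 0 :=
      (continuousAt_const.div (continuousAt_const.sub continuousAt_id) (by simp; linarith)).sub
        (continuousAt_const.div (continuousAt_const.add continuousAt_id) (by simp; linarith))
    exact this.tendsto
  rw [sub_zero, add_zero] at hc
  obtain ⟨a, ha1, ha2, ha3⟩ := ((hc.eventually_lt_const h0).and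
    ((Ioo_mem_nhdsGT (show (0 : ℝ) < p - 1 by linarith)))).exists
  have hp0 : 1 < p - a := by linarith
  have hq0 : p - a < q + a := by linarith
  have hinv : 1 / (q + a) < 1 / (p - a) := one_div_lt_one_div_of_lt (by linarith) hq0
  have hNi : 1 / (N : ℝ) < 1 := (div_lt_one (by linarith)).2 hN
  set τ : ℝ := 1 + 1 / (q + a) - 1 / (p - a) with hτ
  have hτ0 : 1 - 1 / (N : ℝ) < τ := by linarith
  have hτp : 0 < τ := by linarith
  refine ⟨p - a, q + a, 1 / τ, hp0, by linarith, by linarith, ?_, ?_, ?_⟩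
  · rw [le_div_iff₀ hτp]; linarith
  · rw [mul_one_div, div_lt_iff₀ hτp]
    have : (N : ℝ) * (1 - 1 / N) = N - 1 := by field_simp
    nlinarith
  · rw [one_div_one_div, hτ]; ring

theorem rpow_le_add_mul_rpow {a z r κ : ℝ} (ha : 0 ≤ a) (hz : 1 ≤ z) (hzr : z ≤ r) (hκ : 0 < κ)
    (hκ1 : κ ≤ 1) : a ^ z ≤ κ + κ ^ (1 - r) * a ^ r := by
  have h0 : 0 ≤ κ ^ (1 - r) * a ^ r := by positivity
  rcases le_total a κ with h | h
  · have h1 : a ^ z ≤ κ ^ (1 : ℝ) := (Real.rpow_le_rpow ha h (by linarith)).trans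
      (Real.rpow_le_rpow_of_exponent_ge hκ hκ1 hz)
    rw [Real.rpow_one] at h1
    linarith
  · have h1 : 1 ≤ a / κ := (one_le_div hκ).2 h
    have h2 : a ^ z = κ ^ z * (a / κ) ^ z := by
      rw [← Real.mul_rpow hκ.le (by positivity), mul_div_cancel₀ _ hκ.ne']
    have h3 : κ ^ (1 - r) * a ^ r = κ ^ (1 : ℝ) * (a / κ) ^ r := by
      rw [Real.div_rpow ha hκ.le, Real.rpow_sub hκ]; ring
    have h4 := Real.rpow_le_rpow_of_exponent_ge hκ hκ1 hz
    have h5 := Real.rpow_le_rpow_of_exponent_le h1 hzr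
    rw [h3, h2]
    have := mul_le_mul h4 h5 (by positivity) (by positivity)
    linarith

theorem enorm_sub_average_le {N : ℕ} {u : Euc N → ℝ} {x a : Euc N} {ρ : ℝ} (hρ : 0 < ρ)
    (hu : IntegrableOn u (Metric.ball a ρ)) :
    ‖u x - (volume.real (Metric.ball a ρ))⁻¹ * ∫ z in Metric.ball a ρ, u z‖ₑ ≤
      (volume (Metric.ball a ρ))⁻¹ * ∫⁻ z in Metric.ball a ρ, ‖u x - u z‖ₑ := by
  have hv0 : volume (Metric.ball a ρ) ≠ 0 := (Metric.measure_ball_pos volume a hρ).ne'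
  have hvt : volume (Metric.ball a ρ) ≠ ⊤ := measure_ball_lt_top.ne
  have hvr : 0 < volume.real (Metric.ball a ρ) := ENNReal.toReal_pos hv0 hvt
  have e : u x - (volume.real (Metric.ball a ρ))⁻¹ * ∫ z in Metric.ball a ρ, u z =
      (volume.real (Metric.ball a ρ))⁻¹ * ∫ z in Metric.ball a ρ, (u x - u z) := by
    rw [integral_sub (f := fun _ => u x) (integrableOn_const hvt) hu, setIntegral_const, smul_eq_mul, mul_sub,
      inv_mul_cancel_left₀ hvr.ne']
  rw [e, enorm_mul]
  gcongr
  · rw [Real.enorm_of_nonneg (by positivity), ENNReal.ofReal_inv_of_pos hvr, ofReal_measureReal hvt]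
  · exact enorm_integral_le_lintegral_enorm _

end Exponents

namespace Data
section Local
variable {N : ℕ} (D : Data N)

/-- On a set where `q ≤ r`, smallness in `L^r` implies `modular (v / η) ≤ 1`. Both powers in `H` are
estimated by `a^z ≤ κ + κ^{1-r} a^r`, with `κ` so small that the first term contributes at most `1/2`. -/
theorem exists_modular_le_one (hV : volume D.Ω ≠ ⊤) {m : ℝ} (hm0 : 0 ≤ m)
    (hm : ∀ᵐ x ∂volume.restrict D.Ω, D.μ x ≤ m) {A : Set (Euc N)} (hA : MeasurableSet A)
    {r : ℝ} (hr : ∀ x ∈ D.Ω ∩ A, D.q x ≤ r) (hr0 : 0 < r) {η : ℝ} (hη : 0 < η) :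
    ∃ θ : ℝ≥0∞, 0 < θ ∧ ∀ v : D.M ℝ, (∀ᵐ x ∂volume.restrict D.Ω, x ∉ A → v x = 0) →
      ∫⁻ x in D.Ω ∩ A, ‖v x‖ₑ ^ r ≤ θ → D.modular (η⁻¹ • v) ≤ 1 := by
  have hV0 : 0 ≤ volume.real D.Ω := measureReal_nonneg
  obtain ⟨κ, hκ, hκ1, hκV⟩ : ∃ κ : ℝ, 0 < κ ∧ κ ≤ 1 ∧ (1 + m) * κ * volume.real D.Ω ≤ 1 / 2 := by
    refine ⟨min 1 (1 / (2 * (1 + m) * (volume.real D.Ω + 1))), lt_min one_pos (by positivity),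
      min_le_left _ _, ?_⟩
    calc _ ≤ (1 + m) * (1 / (2 * (1 + m) * (volume.real D.Ω + 1))) * (volume.real D.Ω + 1) := by
          gcongr
          · exact min_le_right _ _
          · linarith
      _ = 1 / 2 := by field_simp
  have hB : 0 < (1 + m) * κ ^ (1 - r) * η⁻¹ ^ r := by positivity
  refine ⟨ENNReal.ofReal (1 / 2 / ((1 + m) * κ ^ (1 - r) * η⁻¹ ^ r)),
    ENNReal.ofReal_pos.2 (by positivity), fun v hv hvθ => ?_⟩
  have hpt : ∀ᵐ x ∂volume.restrict D.Ω, ENNReal.ofReal (D.H x ‖(η⁻¹ • v) x‖) ≤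
      ENNReal.ofReal ((1 + m) * κ) +
        ENNReal.ofReal ((1 + m) * κ ^ (1 - r) * η⁻¹ ^ r) * A.indicator (fun x => ‖v x‖ₑ ^ r) x := by
    filter_upwards [hv, hm, D.ae_good, AEEqFun.coeFn_smul η⁻¹ v,
      ae_restrict_mem D.isOpen.measurableSet] with x h1 h2 h3 h4 h5
    by_cases hx : x ∈ A
    · rw [indicator_of_mem hx, ← ofReal_norm, ENNReal.ofReal_rpow_of_nonneg (norm_nonneg _) hr0.le,
        ← ENNReal.ofReal_mul hB.le, ← ENNReal.ofReal_add (by positivity) (by positivity)]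
      refine ENNReal.ofReal_le_ofReal ?_
      have hpq := (D.p_lt_q x (subset_closure h5)).le
      have hqr := hr x ⟨h5, hx⟩
      have e : ‖(η⁻¹ • v) x‖ = η⁻¹ * ‖v x‖ := by
        rw [h4, Pi.smul_apply, norm_smul, Real.norm_of_nonneg (by positivity)]
      have ha : 0 ≤ η⁻¹ * ‖v x‖ := by positivity
      have k1 := rpow_le_add_mul_rpow ha h3.1.le (hpq.trans hqr) hκ hκ1
      have k2 := rpow_le_add_mul_rpow ha h3.2.1.le hqr hκ hκ1
      have k3 : D.μ x * (η⁻¹ * ‖v x‖) ^ D.q x ≤ m * (κ + κ ^ (1 - r) * (η⁻¹ * ‖v x‖) ^ r) :=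
        mul_le_mul h2 k2 (by positivity) hm0
      have k4 : (η⁻¹ * ‖v x‖) ^ r = η⁻¹ ^ r * ‖v x‖ ^ r :=
        Real.mul_rpow (by positivity) (norm_nonneg _)
      rw [e, H]
      rw [k4] at k1 k3
      calc _ ≤ _ := add_le_add k1 k3
        _ = _ := by ring
    · have : (η⁻¹ • v) x = 0 := by rw [h4, Pi.smul_apply, h1 hx, smul_zero]
      rw [this, H, norm_zero, Real.zero_rpow (by linarith [h3.1]),
        Real.zero_rpow (by linarith [h3.2.1])]
      simp
  calc D.modular (η⁻¹ • v) ≤ ∫⁻ x in D.Ω, (ENNReal.ofReal ((1 + m) * κ) +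
        ENNReal.ofReal ((1 + m) * κ ^ (1 - r) * η⁻¹ ^ r) * A.indicator (fun x => ‖v x‖ₑ ^ r) x) :=
        lintegral_mono_ae hpt
    _ = ENNReal.ofReal ((1 + m) * κ) * volume D.Ω +
        ENNReal.ofReal ((1 + m) * κ ^ (1 - r) * η⁻¹ ^ r) * ∫⁻ x in D.Ω ∩ A, ‖v x‖ₑ ^ r := by
        rw [lintegral_add_left measurable_const, lintegral_const, Measure.restrict_apply_univ,
          lintegral_const_mul' _ _ ENNReal.ofReal_ne_top, lintegral_indicator hA,
          Measure.restrict_restrict hA, inter_comm A]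
    _ ≤ ENNReal.ofReal (1 / 2) + ENNReal.ofReal (1 / 2) := by
        refine add_le_add ?_ ?_
        · rw [← ofReal_measureReal hV, ← ENNReal.ofReal_mul (by positivity)]
          exact ENNReal.ofReal_le_ofReal hκV
        · refine (mul_le_mul_right hvθ _).trans (le_of_eq ?_)
          rw [← ENNReal.ofReal_mul hB.le, mul_div_cancel₀ _ hB.ne']
    _ = 1 := by
        rw [← ENNReal.ofReal_add (by norm_num) (by norm_num)]
        norm_num

theorem lintegral_grad_rpow_le {Ω' : Set (Euc N)} (hΩ' : Ω' ⊆ D.Ω) (hm' : MeasurableSet Ω')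
    {p₀ : ℝ} (hp₀ : 0 ≤ p₀) (hp : ∀ x ∈ Ω', p₀ ≤ D.p x) (G : D.M (Euc N)) (hG : D.modular G ≤ 1) :
    ∫⁻ x in Ω', ‖G x‖ₑ ^ p₀ ≤ volume D.Ω + 1 := by
  calc ∫⁻ x in Ω', ‖G x‖ₑ ^ p₀ ≤ ∫⁻ x in Ω', (1 + ENNReal.ofReal (D.H x ‖G x‖)) := by
        refine lintegral_mono_ae ?_
        filter_upwards [ae_restrict_mem hm', ae_restrict_of_ae_restrict_of_subset hΩ' D.ae_good]
          with x hx hg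
        rw [← ofReal_norm, ENNReal.ofReal_rpow_of_nonneg (norm_nonneg _) hp₀, ← ENNReal.ofReal_one,
          ← ENNReal.ofReal_add zero_le_one (D.H_nonneg hg.2.2 (norm_nonneg _))]
        exact ENNReal.ofReal_le_ofReal
          (D.le_one_add_H hg.2.2 (norm_nonneg _) hp₀ (hp x hx))
    _ ≤ ∫⁻ x in D.Ω, (1 + ENNReal.ofReal (D.H x ‖G x‖)) := lintegral_mono_set hΩ'
    _ = volume D.Ω + D.modular G := by
        rw [lintegral_add_left measurable_const, lintegral_const, one_mul, modular,
          Measure.restrict_apply_univ]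
    _ ≤ _ := by gcongr

end Local
end Data

/-! ### Approximation of the embedding by compact operators -/

theorem norm_le_of_forall_norm_lt_one {X Y : Type*} [NormedAddCommGroup X] [NormedSpace ℝ X]
    [NormedAddCommGroup Y] [NormedSpace ℝ Y] (S : X →L[ℝ] Y) {η : ℝ}
    (h : ∀ w, ‖w‖ < 1 → ‖S w‖ ≤ η) (w : X) : ‖S w‖ ≤ η * ‖w‖ := by
  have key : ∀ δ : ℝ, 0 < δ → ‖S w‖ ≤ η * (‖w‖ + δ) := fun δ hδ => by
    have hpos : 0 < ‖w‖ + δ := by positivity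
    have h1 := h ((‖w‖ + δ)⁻¹ • w) (by
      rw [norm_smul, norm_inv, Real.norm_of_nonneg hpos.le, inv_mul_lt_iff₀ hpos]
      linarith)
    rw [map_smul, norm_smul, norm_inv, Real.norm_of_nonneg hpos.le, inv_mul_le_iff₀ hpos] at h1
    linarith
  refine ge_of_tendsto (x := 𝓝[>] (0 : ℝ)) (f := fun δ => η * (‖w‖ + δ)) ?_ ?_
  · have : Tendsto (fun δ : ℝ => η * (‖w‖ + δ)) (𝓝 0) (𝓝 (η * (‖w‖ + 0))) :=
      (tendsto_const_nhds.add tendsto_id).const_mul _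
    rw [add_zero] at this
    exact this.mono_left nhdsWithin_le_nhds
  · filter_upwards [self_mem_nhdsWithin] with δ hδ using key δ hδ

namespace Data
section LocalApprox
variable {N : ℕ} (D : Data N)

/-- Local approximation in `L^r`, uniform on the unit ball of `W^{1,H}`. The oscillation estimate is
applied on the part of `Ω` near `x₀` where `p₀ ≤ p` and `q ≤ q₀`. -/
theorem exists_local_approx_lintegral (hN : 2 ≤ N) (hV : volume D.Ω ≠ ⊤) {m : ℝ}
    (hm : ∀ᵐ x ∂volume.restrict D.Ω, D.μ x ≤ m) {x₀ : Euc N} (hcone : HasUniformCone D.Ω x₀)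
    (hx₀ : x₀ ∈ closure D.Ω) (hpN : D.p x₀ < N) (hq : D.q x₀ < sobolevConj N (D.p x₀)) :
    ∃ R r : ℝ, 0 < R ∧ 0 < r ∧ (∀ x ∈ D.Ω ∩ Metric.ball x₀ R, D.q x ≤ r) ∧
      ∀ θ : ℝ≥0∞, 0 < θ → ∃ T : Lp ℝ 1 (volume.restrict D.Ω) →L[ℝ] D.LH ℝ,
        IsCompactOperator T ∧
        (∀ f, ∀ᵐ x ∂volume.restrict D.Ω, x ∉ Metric.ball x₀ R → (T f).toM x = 0) ∧
        ∀ w : D.W1H, ‖w‖ < 1 → ∫⁻ x in D.Ω ∩ Metric.ball x₀ R,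
          ‖(D.embed w).toM x - (T (D.toL1 hV (D.embed w))).toM x‖ₑ ^ r ≤ θ := by
  obtain ⟨p₀, q₀, s, hp1, hp₀, hq₀, hs, hsN, hpqs⟩ := exists_subcritical_exponents
    (D.one_lt_p x₀ hx₀) hpN (D.p_lt_q x₀ hx₀) hq
  have hq0 : 0 < q₀ := by linarith [D.one_lt_p x₀ hx₀, D.p_lt_q x₀ hx₀]
  have hs0 : 0 < s := by linarith
  obtain ⟨R₀, hR₀, hR₀'⟩ : ∃ R₀ > 0, ∀ x ∈ Metric.ball x₀ R₀ ∩ closure D.Ω, p₀ < D.p x ∧ D.q x < q₀ :=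
    Metric.mem_nhdsWithin_iff.1 (((D.continuousOn_p x₀ hx₀).eventually_const_lt hp₀).and
      ((D.continuousOn_q x₀ hx₀).eventually_lt_const hq₀))
  obtain ⟨e, k, R₂, he, hk, hk1, hR₂, hcone⟩ := hcone
  obtain ⟨R, hR, hRR₀, hRR₂⟩ : ∃ R : ℝ, 0 < R ∧ 3 * R ≤ R₀ ∧ 3 * R ≤ R₂ :=
    ⟨min R₀ R₂ / 3, by positivity, by linarith [min_le_left R₀ R₂], by linarith [min_le_right R₀ R₂]⟩
  -- The factor three leaves room for a point of `ball x₀ R`, a step of length at most `R` and a ball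
  -- of radius at most `R`.
  set Ω' : Set (Euc N) := D.Ω ∩ Metric.ball x₀ (3 * R) with hΩ'
  have hΩ'o : IsOpen Ω' := D.isOpen.inter Metric.isOpen_ball
  refine ⟨R, q₀, hR, hq0, fun x hx => (hR₀' x ⟨Metric.ball_subset_ball (by linarith) hx.2,
    subset_closure hx.1⟩).2.le, fun θ hθ => ?_⟩
  set β₁ := volume (Metric.ball (0 : Euc N) 1)
  have hb0 : β₁ ≠ 0 := (Metric.measure_ball_pos volume _ one_pos).ne'
  have hbt : β₁ ≠ ⊤ := measure_ball_lt_top.ne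
  set V1 := (volume D.Ω + 1) ^ (q₀ / p₀)
  have hV1 : V1 ≠ ⊤ := ENNReal.rpow_ne_top_of_nonneg (by positivity) (by simp [hV])
  set C := (ENNReal.ofReal ((4 / k) ^ N) * β₁⁻¹) ^ q₀
  have hC : C ≠ ⊤ := ENNReal.rpow_ne_top_of_nonneg hq0.le
    (ENNReal.mul_ne_top ENNReal.ofReal_ne_top (ENNReal.inv_ne_top.2 hb0))
  let I : ℝ → ℝ≥0∞ := fun L =>
    ∫⁻ y in Metric.ball (0 : Euc N) L, ENNReal.ofReal (‖y‖ ^ (-(((N : ℝ) - 1) * s)))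
  -- The scale `ε` is chosen so small that the Young constant is absorbed into `θ`.
  obtain ⟨ε, hε, hεR, hεθ⟩ : ∃ ε : ℝ, 0 < ε ∧ 2 * ε < R ∧
      C * (I (2 * ε) ^ (q₀ / s) * V1) ≤ θ := by
    have h1 : Tendsto (fun ε : ℝ => 2 * ε) (𝓝[>] 0) (𝓝[>] 0) := by
      refine tendsto_nhdsWithin_iff.2 ⟨?_, ?_⟩
      · have : Tendsto (fun ε : ℝ => 2 * ε) (𝓝 0) (𝓝 (2 * 0)) := tendsto_id.const_mul 2
        rw [mul_zero] at this
        exact this.mono_left nhdsWithin_le_nhds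
      · filter_upwards [self_mem_nhdsWithin] with ε hε
        exact mem_Ioi.2 (mul_pos two_pos (mem_Ioi.1 hε))
    have h2 : Tendsto I (𝓝[>] 0) (𝓝 0) := tendsto_lintegral_ball_norm_rpow (by omega) hsN
    have h3 := ((ENNReal.continuous_rpow_const (y := q₀ / s)).tendsto 0).comp (h2.comp h1)
    rw [ENNReal.zero_rpow_of_pos (by positivity)] at h3
    have h4 := ENNReal.Tendsto.const_mul (a := C)
      (ENNReal.Tendsto.mul_const (b := V1) h3 (Or.inr hV1)) (Or.inr hC)
    rw [zero_mul, mul_zero] at h4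
    obtain ⟨ε, ⟨hε1, hε2⟩, hε3⟩ := ((h4.eventually_le_const hθ).and
      (Ioo_mem_nhdsGT (show 0 < R / 2 by positivity))).exists.imp fun _ h => h.symm
    exact ⟨ε, hε1, by linarith, hε3⟩
  obtain ⟨f, hf⟩ := exists_simpleFunc_dist_lt x₀ R (δ := k * ε / 2) (by positivity)
  set ρ := k * ε / 2 with hρ
  have hρ0 : 0 < ρ := by positivity
  let c : SimpleFunc (Euc N) (Euc N) := f.map fun y => y + ε • e
  obtain ⟨T, hT, hTf⟩ := D.exists_finiteRank hV hm (measurableSet_ball (x := x₀) (ε := R)) c ρ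
  refine ⟨T, hT, fun g => ?_, fun w hw => ?_⟩
  · filter_upwards [hTf g] with x hx hxA
    rw [hx, indicator_of_notMem hxA]
  -- Vectors pointing from `x` into the ball attached to `x` lie in the cone.
  have hdir : ∀ x ∈ Metric.ball x₀ R, ∀ z ∈ Metric.ball (c x) ρ, ‖z - x - ε • e‖ < ε * k := by
    intro x hx z hz
    have h1 := hf x hx
    rw [Metric.mem_ball, dist_eq_norm] at hz
    rw [dist_eq_norm] at h1
    have h2 : z - x - ε • e = (z - c x) + (f x - x) := by
      change z - x - ε • e = (z - (f x + ε • e)) + (f x - x)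
      abel
    rw [h2]
    calc _ ≤ _ := norm_add_le _ _
      _ < ρ + ρ := add_lt_add hz h1
      _ = ε * k := by rw [hρ]; ring
  have hlen : ∀ x ∈ Metric.ball x₀ R, ∀ z ∈ Metric.ball (c x) ρ, ‖z - x‖ < 2 * ε := by
    intro x hx z hz
    have h1 := hdir x hx z hz
    have h2 : ‖ε • e‖ = ε := by rw [norm_smul, he, mul_one, Real.norm_of_nonneg hε.le]
    calc ‖z - x‖ = ‖(z - x - ε • e) + ε • e‖ := by rw [sub_add_cancel]
      _ ≤ ‖z - x - ε • e‖ + ‖ε • e‖ := norm_add_le _ _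
      _ < 2 * ε := by nlinarith
  have hhull : ∀ x ∈ D.Ω ∩ Metric.ball x₀ R, ∀ z ∈ Metric.ball (c x) ρ, ∀ t ∈ Icc (0 : ℝ) 1,
      ∀ d ∈ Ioc 0 R, Metric.ball x d ⊆ Ω' → Metric.ball (x + t • (z - x)) d ⊆ Ω' := by
    intro x hx z hz t ht d hd hxd y hy
    have h1 : y - t • (z - x) ∈ Ω' := hxd (by
      rw [mem_ball_iff_norm] at hy ⊢
      convert hy using 2
      abel)
    have h2 : y = (y - t • (z - x)) + ((t * ε) • e + t • (z - x - ε • e)) := by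
      rw [smul_sub t (z - x), smul_smul]; abel
    refine ⟨?_, ?_⟩
    · rw [h2]
      refine hcone _ ⟨h1.1, Metric.ball_subset_ball hRR₂ h1.2⟩ (t * ε)
        ⟨mul_nonneg ht.1 hε.le, ?_⟩ _ ?_
      · nlinarith [ht.2]
      · rw [norm_smul, Real.norm_of_nonneg ht.1, mul_assoc]
        exact mul_le_mul_of_nonneg_left (hdir x hx.2 z hz).le ht.1
    · rw [mem_ball_iff_norm] at hy ⊢
      have h3 := mem_ball_iff_norm.1 hx.2
      have h4 : ‖t • (z - x)‖ ≤ 2 * ε := by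
        rw [norm_smul, Real.norm_of_nonneg ht.1]
        have := hlen x hx.2 z hz
        nlinarith [norm_nonneg (z - x), ht.2, ht.1]
      calc ‖y - x₀‖ = ‖(y - (x + t • (z - x))) + (x - x₀) + t • (z - x)‖ := by congr 1; abel
        _ ≤ ‖y - (x + t • (z - x))‖ + ‖x - x₀‖ + ‖t • (z - x)‖ := norm_add₃_le
        _ < 3 * R := by linarith [hd.2]
  set u := (D.embed w).toM with hu
  set G := (D.grad w).toM with hG
  have hwk : HasWeakGradient D.Ω u G := w.2
  have hui : IntegrableOn u D.Ω := D.integrable_toM hV _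
  have hGm : D.modular G ≤ 1 := D.modular_le_one _ (lt_of_le_of_lt (by
    rw [D.norm_W1H w]; linarith [norm_nonneg (D.embed w)]) hw)
  have hSΩ' : D.Ω ∩ Metric.ball x₀ R ⊆ Ω' :=
    inter_subset_inter_right _ (Metric.ball_subset_ball (by linarith))
  have main := lintegral_oscillation_rpow_le hN hΩ'o G.stronglyMeasurable.measurable
    (hui.mono_set inter_subset_left) (hwk.mono inter_subset_left)
    (D.isOpen.measurableSet.inter measurableSet_ball) hSΩ' c.measurable (ρ := ρ) (L := 2 * ε)
    (d₀ := R) (by positivity) hR (fun x hx z hz => by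
      rw [mem_ball_iff_norm]; exact hlen x hx.2 z hz) hhull hp1.le hs hq0 hpqs
  rw [lintegral_truncRiesz_rpow _ hs0, ENNReal.mul_rpow_of_nonneg _ _ (by positivity),
    ← ENNReal.rpow_mul, mul_div_cancel₀ _ hs0.ne'] at main
  have hGp : (∫⁻ x in Ω', ‖G x‖ₑ ^ p₀) ^ (q₀ / p₀) ≤ V1 := by
    refine ENNReal.rpow_le_rpow ?_ (by positivity)
    exact D.lintegral_grad_rpow_le inter_subset_left hΩ'o.measurableSet (by linarith)
      (fun x hx => (hR₀' x ⟨Metric.ball_subset_ball hRR₀ hx.2, subset_closure hx.1⟩).1.le) G hGm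
  have hvol : ∀ x, volume (Metric.ball (c x) ρ) = ENNReal.ofReal (ρ ^ N) * β₁ := fun x => by
    have : Nontrivial (Euc N) := by
      have : Nonempty (Fin N) := ⟨⟨0, by omega⟩⟩
      infer_instance
    rw [Measure.addHaar_ball volume _ hρ0.le]
    simp [β₁]
  have hpt : ∀ᵐ x ∂volume.restrict (D.Ω ∩ Metric.ball x₀ R),
      ‖u x - (T (D.toL1 hV (D.embed w))).toM x‖ₑ ^ q₀ ≤
        ((ENNReal.ofReal (ρ ^ N) * β₁)⁻¹) ^ q₀ *
          (∫⁻ z in Metric.ball (c x) ρ, ‖u x - u z‖ₑ) ^ q₀ := by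
    filter_upwards [ae_restrict_of_ae_restrict_of_subset inter_subset_left
      (hTf (D.toL1 hV (D.embed w))),
      ae_restrict_mem (D.isOpen.measurableSet.inter measurableSet_ball)] with x h1 hx
    have hBΩ : Metric.ball (c x) ρ ⊆ D.Ω := fun z hz => by
      obtain ⟨d, hd, hdΩ⟩ := Metric.isOpen_iff.1 hΩ'o x (hSΩ' hx)
      have h3 := hhull x hx z hz 1 ⟨zero_le_one, le_rfl⟩ (min d R)
        ⟨lt_min hd hR, min_le_right _ _⟩ ((Metric.ball_subset_ball (min_le_left _ _)).trans hdΩ)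
      rw [one_smul, add_sub_cancel] at h3
      exact (h3 (Metric.mem_ball_self (lt_min hd hR))).1
    rw [h1, indicator_of_mem hx.2, avg_apply, inter_eq_left.2 hBΩ,
      ← ENNReal.mul_rpow_of_nonneg _ _ hq0.le, ← hvol x]
    refine ENNReal.rpow_le_rpow ?_ hq0.le
    exact enorm_sub_average_le hρ0 (hui.mono_set hBΩ)
  have hconst : ((ENNReal.ofReal (ρ ^ N) * β₁)⁻¹) ^ q₀ * ENNReal.ofReal ((2 * ε) ^ N) ^ q₀ = C := by
    rw [← ENNReal.mul_rpow_of_nonneg _ _ hq0.le]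
    congr 1
    rw [ENNReal.mul_inv (Or.inr hbt) (Or.inl ENNReal.ofReal_ne_top), mul_right_comm,
      ← ENNReal.ofReal_inv_of_pos (by positivity), ← ENNReal.ofReal_mul (by positivity)]
    congr 2
    rw [← inv_pow, ← mul_pow]
    congr 1
    rw [hρ]
    field_simp
    norm_num
  calc _ ≤ ∫⁻ x in D.Ω ∩ Metric.ball x₀ R, ((ENNReal.ofReal (ρ ^ N) * β₁)⁻¹) ^ q₀ *
          (∫⁻ z in Metric.ball (c x) ρ, ‖u x - u z‖ₑ) ^ q₀ := lintegral_mono_ae hpt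
    _ = ((ENNReal.ofReal (ρ ^ N) * β₁)⁻¹) ^ q₀ * ∫⁻ x in D.Ω ∩ Metric.ball x₀ R,
          (∫⁻ z in Metric.ball (c x) ρ, ‖u x - u z‖ₑ) ^ q₀ := by
        refine lintegral_const_mul' _ _ (ENNReal.rpow_ne_top_of_nonneg hq0.le ?_)
        rw [ENNReal.inv_ne_top]
        exact mul_ne_zero (ENNReal.ofReal_pos.2 (by positivity)).ne' hb0
    _ ≤ ((ENNReal.ofReal (ρ ^ N) * β₁)⁻¹) ^ q₀ *
          (ENNReal.ofReal ((2 * ε) ^ N) ^ q₀ * I (2 * ε) ^ (q₀ / s) * V1) :=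
        mul_le_mul_right (main.trans (mul_le_mul_right hGp _)) _
    _ = C * (I (2 * ε) ^ (q₀ / s) * V1) := by rw [← hconst]; ring
    _ ≤ θ := hεθ

/-- Local approximation in operator norm of the embedding, cut off to a ball. -/
theorem exists_local_approx (hN : 2 ≤ N) (hV : volume D.Ω ≠ ⊤) {m : ℝ} (hm0 : 0 ≤ m)
    (hm : ∀ᵐ x ∂volume.restrict D.Ω, D.μ x ≤ m) {x₀ : Euc N} (hcone : HasUniformCone D.Ω x₀)
    (hx₀ : x₀ ∈ closure D.Ω) (hpN : D.p x₀ < N) (hq : D.q x₀ < sobolevConj N (D.p x₀)) :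
    ∃ R : ℝ, 0 < R ∧ ∀ η : ℝ, 0 < η → ∃ T : Lp ℝ 1 (volume.restrict D.Ω) →L[ℝ] D.LH ℝ,
      IsCompactOperator T ∧ ∀ w : D.W1H,
        ‖D.restr (measurableSet_ball (x := x₀) (ε := R)) (D.embed w) -
          T (D.toL1 hV (D.embed w))‖ ≤ η * ‖w‖ := by
  obtain ⟨R, r, hR, hr, hqr, h⟩ := D.exists_local_approx_lintegral hN hV hm hcone hx₀ hpN hq
  refine ⟨R, hR, fun η hη => ?_⟩
  obtain ⟨θ, hθ, hmod⟩ := D.exists_modular_le_one hV hm0 hm (measurableSet_ball (x := x₀) (ε := R))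
    hqr hr hη
  obtain ⟨T, hT, hT0, hTθ⟩ := h θ hθ
  refine ⟨T, hT, norm_le_of_forall_norm_lt_one
    ((D.restr measurableSet_ball).comp D.embed - (T.comp (D.toL1 hV)).comp D.embed)
    fun w hw => ?_⟩
  set v := D.restr (measurableSet_ball (x := x₀) (ε := R)) (D.embed w) -
          T (D.toL1 hV (D.embed w)) with hv
  change ‖v‖ ≤ η
  have hvx : ∀ᵐ x ∂volume.restrict D.Ω, v.toM x =
      (Metric.ball x₀ R).indicator (D.embed w).toM x - (T (D.toL1 hV (D.embed w))).toM x := by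
    rw [hv, toM_sub]
    filter_upwards [AEEqFun.coeFn_sub (D.restr (measurableSet_ball (x := x₀) (ε := R))
      (D.embed w)).toM (T (D.toL1 hV (D.embed w))).toM,
      D.restr_coe (measurableSet_ball (x := x₀) (ε := R)) (D.embed w)] with x h1 h2
    rw [h1, Pi.sub_apply, h2]
  refine D.lh_norm_le v hη (hmod v.toM ?_ ?_)
  · filter_upwards [hvx, hT0 (D.toL1 hV (D.embed w))] with x h1 h2 hx
    rw [h1, indicator_of_notMem hx, h2 hx, sub_zero]
  · refine le_trans (le_of_eq (lintegral_congr_ae ?_)) (hTθ w hw)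
    filter_upwards [ae_restrict_of_ae_restrict_of_subset inter_subset_left hvx,
      ae_restrict_mem (D.isOpen.measurableSet.inter measurableSet_ball)] with x h1 hx
    rw [h1, indicator_of_mem hx.2]

/-- The embedding is approximated in operator norm by compact operators that factor through `L¹(Ω)`. -/
theorem exists_approx (hN : 2 ≤ N) (hb : Bornology.IsBounded D.Ω) (hV : volume D.Ω ≠ ⊤) {m : ℝ}
    (hm0 : 0 ≤ m) (hm : ∀ᵐ x ∂volume.restrict D.Ω, D.μ x ≤ m) (hlip : HasLipschitzBoundary D.Ω)
    (hpN : ∀ x ∈ closure D.Ω, D.p x < N)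
    (hq : ∀ x ∈ closure D.Ω, D.q x < sobolevConj N (D.p x)) {η : ℝ} (hη : 0 < η) :
    ∃ T : Lp ℝ 1 (volume.restrict D.Ω) →L[ℝ] D.LH ℝ, IsCompactOperator T ∧
      ∀ w : D.W1H, ‖D.embed w - T (D.toL1 hV (D.embed w))‖ ≤ η * ‖w‖ := by
  let Q : Set (Euc N) → Prop := fun S => ∃ A, ∃ hA : MeasurableSet A, S ⊆ A ∧
    ∀ η : ℝ, 0 < η → ∃ T : Lp ℝ 1 (volume.restrict D.Ω) →L[ℝ] D.LH ℝ, IsCompactOperator T ∧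
      ∀ w : D.W1H, ‖D.restr hA (D.embed w) - T (D.toL1 hV (D.embed w))‖ ≤ η * ‖w‖
  have hQ : Q (closure D.Ω) := by
    refine IsCompact.induction_on (p := Q) hb.isCompact_closure ?_ ?_ ?_ ?_
    · refine ⟨∅, MeasurableSet.empty, subset_rfl, fun η hη => ⟨0, isCompactOperator_zero, fun w => ?_⟩⟩
      have : D.restr MeasurableSet.empty (D.embed w) = 0 := by
        refine LH.ext_toM (AEEqFun.ext ?_)
        rw [toM_zero]
        filter_upwards [D.restr_coe MeasurableSet.empty (D.embed w), AEEqFun.coeFn_zero (β := ℝ)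
          (μ := volume.restrict D.Ω)] with x h1 h2
        rw [h1, h2]
        simp
      rw [this]
      simp only [zero_apply, sub_self, norm_zero]
      positivity
    · rintro S S' hSS' ⟨A, hA, hSA, h⟩
      exact ⟨A, hA, hSS'.trans hSA, h⟩
    · rintro S S' ⟨A, hA, hSA, h⟩ ⟨A', hA', hSA', h'⟩
      refine ⟨A ∪ A', hA.union hA', union_subset_union hSA hSA', fun η hη => ?_⟩
      obtain ⟨T, hT, hTw⟩ := h (η / 2) (half_pos hη)
      obtain ⟨T', hT', hTw'⟩ := h' (η / 2) (half_pos hη)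
      refine ⟨T + (D.restr hA.compl).comp T', hT.add (hT'.clm_comp (D.restr hA.compl)), fun w => ?_⟩
      rw [D.restr_union hA hA']
      set u := D.embed w
      have e : D.restr hA u + D.restr hA.compl (D.restr hA' u) -
          (T + (D.restr hA.compl).comp T') (D.toL1 hV u) =
          (D.restr hA u - T (D.toL1 hV u)) +
            D.restr hA.compl (D.restr hA' u - T' (D.toL1 hV u)) := by
        rw [map_sub]
        simp only [add_apply, ContinuousLinearMap.comp_apply]
        abel
      rw [e]
      refine (norm_add_le _ _).trans ?_
      have := (D.norm_restr_le hA.compl (D.restr hA' u - T' (D.toL1 hV u))).trans (hTw' w)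
      linarith [hTw w]
    · intro x hx
      obtain ⟨R, hR, h⟩ := D.exists_local_approx hN hV hm0 hm
        (hlip.hasUniformCone_of_mem_closure (by omega) D.isOpen hx) hx (hpN x hx) (hq x hx)
      exact ⟨Metric.ball x R, mem_nhdsWithin_of_mem_nhds (Metric.ball_mem_nhds x hR),
        Metric.ball x R, measurableSet_ball, subset_rfl, h⟩
  obtain ⟨A, hA, hΩA, h⟩ := hQ
  obtain ⟨T, hT, hTw⟩ := h η hη
  refine ⟨T, hT, fun w => ?_⟩
  have e : D.restr hA (D.embed w) = D.embed w := by
    refine LH.ext_toM (AEEqFun.ext ?_)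
    filter_upwards [D.restr_coe hA (D.embed w), ae_restrict_mem D.isOpen.measurableSet] with x h1 h2
    rw [h1, indicator_of_mem (hΩA (subset_closure h2))]
  simpa only [e] using hTw w

end LocalApprox
end Data

/-! ### Uniqueness of weak gradients, compactness and the Poincaré inequality -/

section WeakGradient
variable {N : ℕ}

theorem HasWeakGradient.ae_eq {Ω : Set (Euc N)} (hΩ : IsOpen Ω) {u : Euc N → ℝ}
    {G G' : Euc N → Euc N} (h : HasWeakGradient Ω u G) (h' : HasWeakGradient Ω u G') :
    G =ᵐ[volume.restrict Ω] G' := by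
  have hi : ∀ i : Fin N, ∀ᵐ x, x ∈ Ω → G x i - G' x i = 0 := by
    intro i
    refine hΩ.ae_eq_zero_of_integral_contDiff_smul_eq_zero ?_ fun g hg hgc hgs => ?_
    · refine (locallyIntegrableOn_iff hΩ.isLocallyClosed).2 fun K hK hc => ?_
      exact ((EuclideanSpace.proj (𝕜 := ℝ) i).integrable_comp (h.locInt_grad K hK hc)).sub
        ((EuclideanSpace.proj (𝕜 := ℝ) i).integrable_comp (h'.locInt_grad K hK hc))
    · have hφ : IsTestFunction Ω g := ⟨hg, hgc, hgs⟩
      have e : ∀ x, g x • (G x i - G' x i) = G x i * g x - G' x i * g x := fun x => by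
        rw [smul_eq_mul]; ring
      rw [← setIntegral_eq_integral_of_forall_compl_eq_zero (s := Ω)
        fun x hx => by rw [hφ.eq_zero_of_notMem hx, zero_smul]]
      simp_rw [e]
      rw [integral_sub (hφ.integrable_pair h i).2 (hφ.integrable_pair h' i).2]
      linarith [h.integral_eq g hφ i, h'.integral_eq g hφ i]
  filter_upwards [(ae_restrict_iff' hΩ.measurableSet).2 (ae_all_iff.2 hi |>.mono
    fun x hx hxΩ i => hx i hxΩ)] with x hx
  ext i
  exact sub_eq_zero.1 (hx i)

theorem IsTestFunction.hasWeakGradient {Ω : Set (Euc N)} {φ : Euc N → ℝ}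
    (hφ : IsTestFunction Ω φ) : HasWeakGradient Ω φ (gradient φ) := by
  have hφ1 : ContDiff ℝ 1 φ := hφ.smooth.of_le (by simp)
  have hgc : Continuous (gradient φ) :=
    (InnerProductSpace.toDual ℝ (Euc N)).symm.continuous.comp (hφ1.continuous_fderiv one_ne_zero)
  refine ⟨fun K _ hK => hφ1.continuous.continuousOn.integrableOn_compact hK,
    fun K _ hK => hgc.continuousOn.integrableOn_compact hK, fun ψ hψ i => ?_⟩
  have hψ1 : ContDiff ℝ 1 ψ := hψ.smooth.of_le (by simp)
  have hg : ∀ x, gradient φ x i = fderiv ℝ φ x (EuclideanSpace.single i 1) := fun x => by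
    have h1 : inner ℝ (gradient φ x) (EuclideanSpace.single i 1) =
        fderiv ℝ φ x (EuclideanSpace.single i 1) := InnerProductSpace.toDual_symm_apply
    rw [← h1, EuclideanSpace.inner_single_right]
    simp
  have c1 : Continuous fun x => fderiv ℝ φ x (EuclideanSpace.single i 1) :=
    (hφ1.continuous_fderiv one_ne_zero).clm_apply continuous_const
  have c2 : Continuous fun x => fderiv ℝ ψ x (EuclideanSpace.single i 1) :=
    (hψ1.continuous_fderiv one_ne_zero).clm_apply continuous_const
  simp_rw [hg]
  rw [setIntegral_eq_integral_of_forall_compl_eq_zero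
      fun x hx => by simp [hψ.fderiv_eq_zero_of_notMem hx],
    setIntegral_eq_integral_of_forall_compl_eq_zero
      fun x hx => by simp [hψ.eq_zero_of_notMem hx]]
  refine integral_mul_fderiv_eq_neg_fderiv_mul_of_integrable ?_ ?_ ?_
    (fun x _ => hφ1.differentiable one_ne_zero x) (fun x _ => hψ1.differentiable one_ne_zero x)
  · exact (c1.mul hψ1.continuous).integrable_of_hasCompactSupport
      (hψ.hasCompactSupport.mul_left (f := fun x => fderiv ℝ φ x (EuclideanSpace.single i 1)))
  · exact (hφ1.continuous.mul c2).integrable_of_hasCompactSupport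
      (hφ.hasCompactSupport.mul_right (f' := fun x => fderiv ℝ ψ x (EuclideanSpace.single i 1)))
  · exact (hφ1.continuous.mul hψ1.continuous).integrable_of_hasCompactSupport
      hφ.hasCompactSupport.mul_right

/-- The `L¹` Poincaré inequality for test functions, a case of the Gagliardo-Nirenberg-Sobolev
inequality. -/
theorem exists_lintegral_le_lintegral_gradient (hN : 2 ≤ N) {Ω : Set (Euc N)}
    (hb : Bornology.IsBounded Ω) : ∃ K : NNReal, ∀ φ, IsTestFunction Ω φ →
      ∫⁻ x in Ω, ‖φ x‖ₑ ≤ K * ∫⁻ x in Ω, ‖gradient φ x‖ₑ := by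
  refine ⟨eLpNormLESNormFDerivOfLeConst ℝ (volume : Measure (Euc N)) Ω 1 1, fun φ hφ => ?_⟩
  have h := eLpNorm_le_eLpNorm_fderiv (volume : Measure (Euc N)) (p := 1) (F := ℝ)
    (hφ.smooth.of_le (by simp)) ((subset_tsupport φ).trans hφ.tsupport_subset) le_rfl
    (by rw [finrank_euclideanSpace_fin]; exact_mod_cast hN) hb
  rw [ENNReal.coe_one, eLpNorm_one_eq_lintegral_enorm, eLpNorm_one_eq_lintegral_enorm] at h
  have e : ∫⁻ x in Ω, ‖gradient φ x‖ₑ = ∫⁻ x, ‖fderiv ℝ φ x‖ₑ := by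
    rw [← setLIntegral_eq_of_support_subset (s := Ω) (f := fun x => ‖fderiv ℝ φ x‖ₑ)]
    · refine lintegral_congr fun x => ?_
      rw [← ofReal_norm, ← ofReal_norm, gradient, LinearIsometryEquiv.norm_map]
    · intro x hx
      by_contra hxΩ
      refine hx ?_
      change ‖fderiv ℝ φ x‖ₑ = 0
      rw [← ofReal_norm, hφ.fderiv_eq_zero_of_notMem hxΩ, norm_zero, ENNReal.ofReal_zero]
  rw [e]
  exact (setLIntegral_le_lintegral _ _).trans h

end WeakGradient

theorem isCompactOperator_of_forall_norm_sub_le {X Y : Type*} [NormedAddCommGroup X]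
    [NormedSpace ℝ X] [NormedAddCommGroup Y] [NormedSpace ℝ Y] [CompleteSpace Y] (f : X →L[ℝ] Y)
    (h : ∀ η : ℝ, 0 < η → ∃ S : X →L[ℝ] Y, IsCompactOperator S ∧
      ∀ w, ‖f w - S w‖ ≤ η * ‖w‖) : IsCompactOperator f := by
  choose S hS hSw using fun n : ℕ => h (1 / ((n : ℝ) + 1)) (by positivity)
  refine isCompactOperator_of_tendsto (l := atTop) (F := S) ?_ (Eventually.of_forall hS)
  rw [tendsto_iff_norm_sub_tendsto_zero]
  refine squeeze_zero (fun _ => norm_nonneg _) (fun n => ?_) tendsto_one_div_add_atTop_nhds_zero_nat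
  refine ContinuousLinearMap.opNorm_le_bound _ (by positivity) fun w => ?_
  rw [← norm_neg]
  simpa using hSw n w

namespace Data
section Poincare
variable {N : ℕ} (D : Data N)

theorem embed_injective : Function.Injective D.embed := by
  intro v w h
  have h1 : v.1.fst = w.1.fst := h
  have hv : HasWeakGradient D.Ω v.1.fst.toM v.1.snd.toM := v.2
  have hw : HasWeakGradient D.Ω v.1.fst.toM w.1.snd.toM := h1 ▸ w.2
  have h2 : v.1.snd = w.1.snd := LH.ext_toM (AEEqFun.ext (hv.ae_eq D.isOpen hw))
  exact Subtype.ext (WithLp.ofLp_injective 1 (Prod.ext h1 h2))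

theorem exists_norm_toL1_le (hN : 2 ≤ N) (hb : Bornology.IsBounded D.Ω) (hV : volume D.Ω ≠ ⊤) :
    ∃ K : ℝ, 0 ≤ K ∧ ∀ w ∈ D.W01H, ‖D.toL1 hV (D.embed w)‖ ≤ K * ‖D.toL1 hV (D.grad w)‖ := by
  obtain ⟨K, hK⟩ := exists_lintegral_le_lintegral_gradient hN hb
  refine ⟨K, K.2, fun w hw => ?_⟩
  have hcl : IsClosed {w : D.W1H | ‖D.toL1 hV (D.embed w)‖ ≤ K * ‖D.toL1 hV (D.grad w)‖} :=
    isClosed_le ((D.toL1 hV).continuous.comp D.embed.continuous).norm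
      (((D.toL1 hV).continuous.comp D.grad.continuous).norm.const_mul _)
  refine closure_minimal (fun w hw => ?_) hcl hw
  obtain ⟨φ, hφ, hwφ⟩ := hw
  have hwk : HasWeakGradient D.Ω φ (D.grad w).toM :=
    HasWeakGradient.congr (show HasWeakGradient D.Ω (D.embed w).toM (D.grad w).toM from w.2)
      hwφ.symm EventuallyEq.rfl
  have hG := hwk.ae_eq D.isOpen hφ.hasWeakGradient
  have h := hK φ hφ
  have e1 : ∫⁻ x in D.Ω, ‖φ x‖ₑ = ‖D.toL1 hV (D.embed w)‖ₑ := by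
    rw [Lp.enorm_def, eLpNorm_one_eq_lintegral_enorm]
    exact lintegral_congr_ae (hwφ.mono fun x hx => by simp only [← hx]; rfl)
  have e2 : ∫⁻ x in D.Ω, ‖gradient φ x‖ₑ = ‖D.toL1 hV (D.grad w)‖ₑ := by
    rw [Lp.enorm_def, eLpNorm_one_eq_lintegral_enorm]
    exact lintegral_congr_ae (hG.mono fun x hx => by simp only [← hx]; rfl)
  rw [e1, e2] at h
  have h' := ENNReal.toReal_mono (ENNReal.mul_ne_top ENNReal.coe_ne_top enorm_ne_top) h
  simpa using h'

/-- An approximation of the embedding with error `1/2` bounds `‖u‖_H` by `‖∇u‖_H` and `‖u‖_{L¹}`, and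
the latter is controlled by the `L¹` Poincaré inequality. -/
theorem exists_poincare (hN : 2 ≤ N) (hb : Bornology.IsBounded D.Ω) (hV : volume D.Ω ≠ ⊤)
    (T : Lp ℝ 1 (volume.restrict D.Ω) →L[ℝ] D.LH ℝ)
    (hT : ∀ w : D.W1H, ‖D.embed w - T (D.toL1 hV (D.embed w))‖ ≤ 1 / 2 * ‖w‖) :
    ∃ C : ℝ, 0 < C ∧ ∀ u ∈ D.W01H, ‖D.embed u‖ ≤ C * ‖D.grad u‖ := by
  obtain ⟨K, hK0, hK⟩ := D.exists_norm_toL1_le hN hb hV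
  set B := D.toL1 (F := Euc N) hV
  refine ⟨1 + 2 * (‖T‖ * (K * ‖B‖)), by positivity, fun u hu => ?_⟩
  have h1 := hT u
  rw [D.norm_W1H] at h1
  have h2 : ‖T (D.toL1 hV (D.embed u))‖ ≤ ‖T‖ * (K * ‖B‖) * ‖D.grad u‖ := by
    calc _ ≤ ‖T‖ * ‖D.toL1 hV (D.embed u)‖ := T.le_opNorm _
      _ ≤ ‖T‖ * (K * (‖B‖ * ‖D.grad u‖)) := by
          gcongr
          exact (hK u hu).trans (mul_le_mul_of_nonneg_left (B.le_opNorm _) hK0)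
      _ = _ := by ring
  have h3 := norm_sub_norm_le (D.embed u) (T (D.toL1 hV (D.embed u)))
  linarith

theorem isCompactOperator_embed (hV : volume D.Ω ≠ ⊤)
    (h : ∀ η : ℝ, 0 < η → ∃ T : Lp ℝ 1 (volume.restrict D.Ω) →L[ℝ] D.LH ℝ, IsCompactOperator T ∧
      ∀ w : D.W1H, ‖D.embed w - T (D.toL1 hV (D.embed w))‖ ≤ η * ‖w‖) :
    IsCompactOperator D.embed := by
  have := D.completeSpace_LH (F := ℝ) hV
  refine isCompactOperator_of_forall_norm_sub_le D.embed fun η hη => ?_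
  obtain ⟨T, hT, hTw⟩ := h η hη
  exact ⟨T.comp ((D.toL1 hV).comp D.embed), hT.comp_clm ((D.toL1 hV).comp D.embed), hTw⟩

end Poincare
end Data

end DoublePhase

end

theorem mainTheorem10 (N : ℕ) (hN : 2 ≤ N) (D : DoublePhase.Data N)
    (hbounded : Bornology.IsBounded D.Ω) (hconn : IsConnected D.Ω)
    (hlip : DoublePhase.HasLipschitzBoundary D.Ω)
    (hμ : MemLp D.μ ∞ (volume.restrict D.Ω))
    (hpN : ∀ x ∈ closure D.Ω, D.p x < N)
    (hq : ∀ x ∈ closure D.Ω, D.q x < DoublePhase.sobolevConj N (D.p x)) :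
    (Function.Injective D.embed ∧ IsCompactOperator D.embed) ∧
    (∃ C : ℝ, 0 < C ∧ ∀ u ∈ D.W01H, ‖D.embed u‖ ≤ C * ‖D.grad u‖) ∧
    ((∀ u : D.W01H, D.gradSeminorm u = 0 → u = 0) ∧
      ∃ c₁ c₂ : ℝ, 0 < c₁ ∧ 0 < c₂ ∧
        ∀ u : D.W01H, c₁ * ‖u‖ ≤ D.gradSeminorm u ∧ D.gradSeminorm u ≤ c₂ * ‖u‖) := by
  have hV : volume D.Ω ≠ ⊤ := hbounded.measure_lt_top.ne
  have hm : ∀ᵐ x ∂volume.restrict D.Ω,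
      D.μ x ≤ (eLpNorm D.μ ∞ (volume.restrict D.Ω)).toReal := by
    have h1 := ae_le_eLpNormEssSup (f := D.μ) (μ := volume.restrict D.Ω)
    filter_upwards [h1] with x hx
    rw [← eLpNorm_exponent_top] at hx
    refine (le_abs_self _).trans ?_
    simpa using ENNReal.toReal_mono hμ.2.ne hx
  have happrox := fun η (hη : 0 < η) => D.exists_approx hN hbounded hV ENNReal.toReal_nonneg hm
    hlip hpN hq (η := η) hη
  obtain ⟨T, -, hT⟩ := happrox (1 / 2) (by norm_num)
  obtain ⟨C, hC, hpoinc⟩ := D.exists_poincare hN hbounded hV T hT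
  have hlow : ∀ u : D.W01H, ‖u‖ ≤ (C + 1) * D.gradSeminorm u := fun u => by
    have h1 : ‖u‖ = ‖D.embed u.1‖ + ‖D.grad u.1‖ := D.norm_W1H u.1
    have h2 := hpoinc u.1 u.2
    change ‖u‖ ≤ (C + 1) * ‖D.grad u.1‖
    linarith
  refine ⟨⟨D.embed_injective, D.isCompactOperator_embed hV happrox⟩, ⟨C, hC, hpoinc⟩,
    fun u hu => ?_, (C + 1)⁻¹, 1, by positivity, one_pos, fun u => ⟨?_, ?_⟩⟩
  · have h1 := hlow u
    rw [hu, mul_zero] at h1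
    exact norm_le_zero_iff.1 h1
  · rw [inv_mul_le_iff₀ (by positivity)]
    exact hlow u
  · have h1 : ‖u‖ = ‖D.embed u.1‖ + ‖D.grad u.1‖ := D.norm_W1H u.1
    change ‖D.grad u.1‖ ≤ 1 * ‖u‖
    linarith [norm_nonneg (D.embed u.1)]
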